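/- \textbf{Setting.} An \emph{enhanced 2-category} is a (strict) 2-category $\mathcal K$ with a wide, locally full sub-2-category of \emph{tight} 1-cells; arbitrary 1-cells are called loose. A \emph{discrete opfibration} is a 1-cell $p:E\to B$ such that for all $e:X\to E$, $b:X\to B$ and $\varphi:pe\Rightarrow b$ there is a unique pair $(e',\lambda:e\Rightarrow e')$ with $pe'=b$ and $p\lambda=\varphi$. A \emph{left-tight pullback} of a tight $p:E\to B$ along a loose $f:A\to B$ is a strict 2-pullback $P$ whose projection $P\to A$ is tight and detects tightness (if $X\to P\to A$ is tight then so is $X\to P$). $\mathcal K$ is a \emph{plumbus} if it has a tight terminal object $1$ (a terminal object all maps into which are tight) and all left-tight pullbacks of tight discrete opfibrations along loose maps. Fix in the plumbus $\mathcal K$ a class of tight discrete opfibrations, called \emph{small}, stable under left-tight pullback along loose maps and containing $\mathrm{id}_1$. For a small $u:\Omega_\bullet\to\Omega$, a map $f:B\to\Omega$ \emph{classifies} $p:E\to B$ if there is a left-tight pullback square exhibiting $p$ as the pullback of $u$ along $f$. Suppose that $u$ is a \emph{2-classifier}: for every $B$ the functor $f\mapsto f^*u$ from $\mathcal K(B,\Omega)$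 to tight discrete opfibrations over $B$ is fully faithful, and every small discrete opfibration is classified by some $f$. Let $(T,i,m)$ be a 2-monad on $\mathcal K$ such that $T$ preserves tightness and $i,m$ have tight components. Let $\mathrm{Alg}_{\mathrm{lx}}(T)$ be the enhanced 2-category of strict $T$-algebras with tight structure map, lax $T$-morphisms and $T$-2-morphisms, whose tight 1-cells are the strict $T$-morphisms that are tight in $\mathcal K$. A tight discrete opfibration of $\mathrm{Alg}_{\mathrm{lx}}(T)$ is called small if its underlying 1-cell is small in $\mathcal K$. Suppose that \begin{enumerate} \item[(A)] $Tu$ is small; \item[(B)] $T$ sends each left-tight pullback of $u$ to a strict 2-pullback; \item[(C)] the naturality squares of $i$ and $m$ at $u$ are strict 2-pullbacks; \item[(D)] $Tu$ has a tight classifying map $\omega:T\Omega\to\Omega$, say with classifying pullback square having top side $\omega_\bullet:T\Omega_\bullet\to\Omega_\bullet$; \item[(E)] $(\Omega,\omega)$ is a strict $T$-algebra. \end{enumerate} \textbf{Statement.} Then $\omega_\bullet$ is a tight strict $T$-algebra structure on $\Omega_\bullet$ (so that $u$ is a strict $T$-morphism $(\Omega_\bullet,\omega_\bullet)\to(\Omega,\omega)$),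 and for every small discrete opfibration $p:(E,\eta)\to(B,\beta)$ in $\mathrm{Alg}_{\mathrm{lx}}(T)$: \begin{enumerate} \item there is a lax $T$-morphism $\mathrm dp:(B,\beta)\to(\Omega,\omega)$ that classifies $p$ with respect to $u$ in $\mathrm{Alg}_{\mathrm{lx}}(T)$; \item every such lax classifying map $\mathrm dp$ is a pseudo $T$-morphism (its laxator is invertible) if and only if $p$ is $T$-cartesian, i.e. the $T$-cartesianity defect $\delta_p:TE\to\beta^*E$ -- the comparison map with components $\eta:TE\to E$ and $Tp:TE\to TB$ into the pullback in $\mathcal K$ of $p$ along $\beta:TB\to B$ -- is a split equivalence in $\mathcal K$ (there is $s$ with $\delta_p s=\mathrm{id}$ and $s\delta_p\cong\mathrm{id}$). \end{enumerate} -/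

import Mathlib

open CategoryTheory Bicategory

universe w v u

/-! ## Equality of 2-cells in a strict 2-category

A 2-category is a bicategory `K` with `Bicategory.Strict K`. Since composition of 1-cells is only
propositionally associative and unital, 2-cells are compared together with their boundaries. -/

section CellEq

variable {K : Type u} [Bicategory.{w, v} K]

/-- Two 2-cells are equal, after identifying their (equal) sources and (equal) targets. -/
def CellEq {a b : K} {f g f' g' : a ⟶ b} (φ : f ⟶ g) (ψ : f' ⟶ g') : Prop :=
  f = f' ∧ g = g' ∧ HEq φ ψ

infix:50 " ≗ " => CellEq

theorem cellEq_iff {a b : K} {f g f' g' : a ⟶ b} {φ : f ⟶ g} {ψ : f' ⟶ g'} :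
    φ ≗ ψ ↔ ∃ (h : f = f') (k : g = g'), φ ≫ eqToHom k = eqToHom h ≫ ψ := by
  constructor
  · rintro ⟨rfl, rfl, h⟩
    exact ⟨rfl, rfl, by simpa using eq_of_heq h⟩
  · rintro ⟨rfl, rfl, h⟩
    exact ⟨rfl, rfl, by simpa using h⟩

namespace CellEq

variable {a b c d : K}

theorem refl {f g : a ⟶ b} (φ : f ⟶ g) : φ ≗ φ := ⟨rfl, rfl, HEq.rfl⟩

theorem of_eq {f g : a ⟶ b} {φ ψ : f ⟶ g} (h : φ = ψ) : φ ≗ ψ := h ▸ refl φ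

theorem eq {f g : a ⟶ b} {φ ψ : f ⟶ g} (h : φ ≗ ψ) : φ = ψ := eq_of_heq h.2.2

theorem symm {f g f' g' : a ⟶ b} {φ : f ⟶ g} {ψ : f' ⟶ g'} (h : φ ≗ ψ) : ψ ≗ φ :=
  ⟨h.1.symm, h.2.1.symm, h.2.2.symm⟩

theorem trans {f g f' g' f'' g'' : a ⟶ b} {φ : f ⟶ g} {ψ : f' ⟶ g'} {χ : f'' ⟶ g''}
    (h : φ ≗ ψ) (k : ψ ≗ χ) : φ ≗ χ :=
  ⟨h.1.trans k.1, h.2.1.trans k.2.1, h.2.2.trans k.2.2⟩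

theorem comp {f g h f' g' h' : a ⟶ b} {φ : f ⟶ g} {ψ : g ⟶ h} {φ' : f' ⟶ g'} {ψ' : g' ⟶ h'}
    (e₁ : φ ≗ φ') (e₂ : ψ ≗ ψ') : φ ≫ ψ ≗ φ' ≫ ψ' := by
  obtain ⟨rfl, rfl, e₁⟩ := e₁
  obtain ⟨-, rfl, e₂⟩ := e₂
  obtain rfl := eq_of_heq e₁
  obtain rfl := eq_of_heq e₂
  exact refl _

theorem eqToHom_comp {f g h : a ⟶ b} (e : f = g) (φ : g ⟶ h) : eqToHom e ≫ φ ≗ φ := by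
  subst e
  exact of_eq (by simp)

theorem comp_eqToHom {f g h : a ⟶ b} (φ : f ⟶ g) (e : g = h) : φ ≫ eqToHom e ≗ φ := by
  subst e
  exact of_eq (by simp)

theorem eqToHom_left {f g : a ⟶ b} (e : f = g) : eqToHom e ≗ 𝟙 f := by
  subst e
  exact refl _

theorem id_congr {f g : a ⟶ b} (e : f = g) : 𝟙 f ≗ 𝟙 g := by
  subst e
  exact refl _

theorem whiskerLeft {f f' : a ⟶ b} {g h g' h' : b ⟶ c} {φ : g ⟶ h} {ψ : g' ⟶ h'}
    (e : f = f') (k : φ ≗ ψ) : f ◁ φ ≗ f' ◁ ψ := by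
  obtain ⟨rfl, rfl, k⟩ := k
  obtain rfl := eq_of_heq k
  subst e
  exact refl _

theorem whiskerRight {f g f' g' : a ⟶ b} {h h' : b ⟶ c} {φ : f ⟶ g} {ψ : f' ⟶ g'}
    (k : φ ≗ ψ) (e : h = h') : φ ▷ h ≗ ψ ▷ h' := by
  obtain ⟨rfl, rfl, k⟩ := k
  obtain rfl := eq_of_heq k
  subst e
  exact refl _

theorem conj {f f' g g' : a ⟶ b} (e : f = f') (φ : f' ⟶ g') (e' : g' = g) :
    eqToHom e ≫ φ ≫ eqToHom e' ≗ φ :=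
  (eqToHom_comp _ _).trans (comp_eqToHom _ _)

/-- Congruence for vertical composites through equal, but not syntactically equal, 1-cells. -/
theorem paste {f g g₁ h f' g' g₁' h' : a ⟶ b} {φ : f ⟶ g} {ψ : g₁ ⟶ h} {φ' : f' ⟶ g'}
    {ψ' : g₁' ⟶ h'} (e : g = g₁) (e' : g' = g₁') (k₁ : φ ≗ φ') (k₂ : ψ ≗ ψ') :
    φ ≫ eqToHom e ≫ ψ ≗ φ' ≫ eqToHom e' ≫ ψ' :=
  k₁.comp ((eqToHom_comp _ _).trans (k₂.trans (eqToHom_comp _ _).symm))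

theorem eqToIso_hom_id {f g : a ⟶ b} {φ : f ≅ g} {e : f = g} (h : φ = eqToIso e) :
    φ.hom ≗ 𝟙 f := by
  subst e h
  exact refl _

theorem eqToIso_inv_id {f g : a ⟶ b} {φ : f ≅ g} {e : f = g} (h : φ = eqToIso e) :
    φ.inv ≗ 𝟙 g := by
  subst e h
  exact refl _

variable [Bicategory.Strict K]

theorem comp_whiskerLeft (f : a ⟶ b) (g : b ⟶ c) {h h' : c ⟶ d} (φ : h ⟶ h') :
    (f ≫ g) ◁ φ ≗ f ◁ g ◁ φ := by
  rw [Bicategory.comp_whiskerLeft, Strict.associator_eqToIso, Strict.associator_eqToIso]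
  simp only [eqToIso.hom, eqToIso.inv]
  exact conj _ _ _

theorem whiskerRight_comp {f f' : a ⟶ b} (φ : f ⟶ f') (g : b ⟶ c) (h : c ⟶ d) :
    φ ▷ (g ≫ h) ≗ φ ▷ g ▷ h := by
  rw [Bicategory.whiskerRight_comp, Strict.associator_eqToIso, Strict.associator_eqToIso]
  simp only [eqToIso.hom, eqToIso.inv]
  exact conj _ _ _

theorem whisker_assoc (f : a ⟶ b) {g g' : b ⟶ c} (φ : g ⟶ g') (h : c ⟶ d) :
    (f ◁ φ) ▷ h ≗ f ◁ φ ▷ h := by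
  rw [Bicategory.whisker_assoc, Strict.associator_eqToIso, Strict.associator_eqToIso]
  simp only [eqToIso.hom, eqToIso.inv]
  exact conj _ _ _

theorem id_whiskerLeft {f f' : a ⟶ b} (φ : f ⟶ f') : 𝟙 a ◁ φ ≗ φ := by
  rw [Bicategory.id_whiskerLeft, Strict.leftUnitor_eqToIso, Strict.leftUnitor_eqToIso]
  simp only [eqToIso.hom, eqToIso.inv]
  exact conj _ _ _

theorem whiskerRight_id {f f' : a ⟶ b} (φ : f ⟶ f') : φ ▷ 𝟙 b ≗ φ := by
  rw [Bicategory.whiskerRight_id, Strict.rightUnitor_eqToIso, Strict.rightUnitor_eqToIso]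
  simp only [eqToIso.hom, eqToIso.inv]
  exact conj _ _ _

end CellEq

end CellEq

/-! ## Enhanced 2-categories, discrete opfibrations, pullbacks -/

/-- An enhancement of a 2-category: a wide, locally full sub-2-category of *tight* 1-cells.
Arbitrary 1-cells are called *loose*. -/
class Enhancement (K : Type u) [Bicategory.{w, v} K] where
  IsTight : ∀ {a b : K}, (a ⟶ b) → Prop
  id_tight : ∀ a : K, IsTight (𝟙 a)
  comp_tight : ∀ {a b c : K} (f : a ⟶ b) (g : b ⟶ c), IsTight f → IsTight g → IsTight (f ≫ g)

section Basic

variable {K : Type u} [Bicategory.{w, v} K]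

/-- `p : E ⟶ B` is a discrete opfibration: every 2-cell `φ : e ≫ p ⟶ b` has a unique lift
`e ⟶ e'` along `p`. -/
def IsDiscOpfib {E B : K} (p : E ⟶ B) : Prop :=
  ∀ ⦃X : K⦄ (e : X ⟶ E) (b : X ⟶ B) (φ : e ≫ p ⟶ b),
    ∃! l : (Σ e' : X ⟶ E, (e ⟶ e')), l.2 ▷ p ≗ φ

/-- The codomain `φ_* e` of the unique lift of `φ : e ≫ p ⟶ b` starting at `e`. -/
noncomputable def IsDiscOpfib.push {E B : K} {p : E ⟶ B} (hp : IsDiscOpfib p)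
    {X : K} (e : X ⟶ E) {b : X ⟶ B} (φ : e ≫ p ⟶ b) : X ⟶ E :=
  (hp e b φ).choose.1

theorem IsDiscOpfib.push_comp {E B : K} {p : E ⟶ B} (hp : IsDiscOpfib p)
    {X : K} (e : X ⟶ E) {b : X ⟶ B} (φ : e ≫ p ⟶ b) : hp.push e φ ≫ p = b :=
  (hp e b φ).choose_spec.1.2.1

/-- The square below is a (strict, 2-dimensional) pullback.
```
  P --top--> E
  |left      | p
  A ---f---> B
```
-/
structure IsTwoPullback {P E A B : K} (top : P ⟶ E) (left : P ⟶ A) (p : E ⟶ B) (f : A ⟶ B) :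
    Prop where
  w : top ≫ p = left ≫ f
  existsUnique_lift : ∀ ⦃X : K⦄ (e : X ⟶ E) (a : X ⟶ A), e ≫ p = a ≫ f →
    ∃! h : X ⟶ P, h ≫ top = e ∧ h ≫ left = a
  existsUnique_lift₂ : ∀ ⦃X : K⦄ (h k : X ⟶ P) (σ : h ≫ top ⟶ k ≫ top)
    (τ : h ≫ left ⟶ k ≫ left), σ ▷ p ≗ τ ▷ f →
    ∃! θ : h ⟶ k, θ ▷ top = σ ∧ θ ▷ left = τ

namespace IsTwoPullback

variable {P E A B : K} {top : P ⟶ E} {left : P ⟶ A} {p : E ⟶ B} {f : A ⟶ B}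

/-- The comparison 1-cell into a pullback. -/
noncomputable def lift (sq : IsTwoPullback top left p f) {X : K} (e : X ⟶ E) (a : X ⟶ A)
    (h : e ≫ p = a ≫ f) : X ⟶ P :=
  (sq.existsUnique_lift e a h).choose

theorem lift_top (sq : IsTwoPullback top left p f) {X : K} (e : X ⟶ E) (a : X ⟶ A)
    (h : e ≫ p = a ≫ f) : sq.lift e a h ≫ top = e :=
  (sq.existsUnique_lift e a h).choose_spec.1.1

theorem lift_left (sq : IsTwoPullback top left p f) {X : K} (e : X ⟶ E) (a : X ⟶ A)
    (h : e ≫ p = a ≫ f) : sq.lift e a h ≫ left = a :=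
  (sq.existsUnique_lift e a h).choose_spec.1.2

/-- The action of pullback of a discrete opfibration `p` on a 2-cell `φ : f ⟶ f'`: the map
`f^* p ⟶ f'^* p` over `A` whose component in `E` is the codomain of the lift of `left ◁ φ`
starting at `top`. -/
noncomputable def reindex (hp : IsDiscOpfib p) (sq : IsTwoPullback top left p f)
    {P' : K} {top' : P' ⟶ E} {left' : P' ⟶ A} {f' : A ⟶ B}
    (sq' : IsTwoPullback top' left' p f') (φ : f ⟶ f') : {h : P ⟶ P' // h ≫ left' = left} :=
  ⟨sq'.lift (hp.push top (eqToHom sq.w ≫ left ◁ φ)) left (hp.push_comp _ _),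
    sq'.lift_left _ _ _⟩

end IsTwoPullback

/-- A split equivalence: `f` has a strict section `s` such that `s` after `f` is isomorphic to the
identity. -/
def IsSplitEquivalence {X Y : K} (f : X ⟶ Y) : Prop :=
  ∃ s : Y ⟶ X, s ≫ f = 𝟙 Y ∧ Nonempty (f ≫ s ≅ 𝟙 X)

variable [Enhancement K]

open Enhancement

/-- A tight discrete opfibration. -/
structure IsTightDiscOpfib {E B : K} (p : E ⟶ B) : Prop where
  tight : IsTight p
  discOpfib : IsDiscOpfib p

/-- A left-tight pullback (of a tight `p` along a loose `f`): a pullback square whose left leg is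
tight and detects tightness. -/
structure IsLeftTightPullback {P E A B : K} (top : P ⟶ E) (left : P ⟶ A) (p : E ⟶ B)
    (f : A ⟶ B) : Prop extends IsTwoPullback top left p f where
  left_tight : IsTight left
  detects_tight : ∀ ⦃X : K⦄ (h : X ⟶ P), IsTight (h ≫ left) → IsTight h

/-- A tight terminal object: a (2-dimensional) terminal object such that all maps into it are
tight. -/
structure IsTightTerminal (one : K) : Prop where
  unique_hom : ∀ X : K, Nonempty (Unique (X ⟶ one))
  unique_cell : ∀ {X : K} (f g : X ⟶ one), Nonempty (Unique (f ⟶ g))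
  tight : ∀ {X : K} (f : X ⟶ one), IsTight f

variable (K) in
/-- A plumbus: an enhanced 2-category with a tight terminal object and all left-tight pullbacks of
tight discrete opfibrations. -/
structure IsPlumbus : Prop where
  exists_terminal : ∃ one : K, IsTightTerminal one
  exists_pullback : ∀ {E A B : K} (p : E ⟶ B) (f : A ⟶ B), IsTightDiscOpfib p →
    ∃ (P : K) (top : P ⟶ E) (left : P ⟶ A), IsLeftTightPullback top left p f

variable (K) in
/-- A pullback-ideal of tight discrete opfibrations, called *small*, containing the identity of the
tight terminal object. -/
structure SmallClass where
  Small : ∀ {E B : K}, (E ⟶ B) → Prop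
  tightDiscOpfib : ∀ {E B : K} {p : E ⟶ B}, Small p → IsTightDiscOpfib p
  pullback_stable : ∀ {P E A B : K} {top : P ⟶ E} {left : P ⟶ A} {p : E ⟶ B} {f : A ⟶ B},
    Small p → IsLeftTightPullback top left p f → Small left
  id_terminal : ∀ {one : K}, IsTightTerminal one → Small (𝟙 one)

/-- `f : B ⟶ Ω` is a classifying map of `p : E ⟶ B` with respect to `u : Ω' ⟶ Ω`: the map `p` is
(a left-tight) pullback of `u` along `f`. -/
def Classifies {Ω' Ω E B : K} (u : Ω' ⟶ Ω) (p : E ⟶ B) (f : B ⟶ Ω) : Prop :=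
  ∃ top : E ⟶ Ω', IsLeftTightPullback top p u f

/-- A 2-classifier for small discrete opfibrations: a small discrete opfibration `u : Ω' ⟶ Ω` such
that pulling back `u` is fully faithful from `K(B, Ω)` to tight discrete opfibrations over `B`, with
essential image the small ones. -/
structure IsTwoClassifier (S : SmallClass K) {Ω' Ω : K} (u : Ω' ⟶ Ω) : Prop where
  small : S.Small u
  fullyFaithful : ∀ {B P P' : K} {f f' : B ⟶ Ω} {top : P ⟶ Ω'} {left : P ⟶ B}
    {top' : P' ⟶ Ω'} {left' : P' ⟶ B} (sq : IsLeftTightPullback top left u f)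
    (sq' : IsLeftTightPullback top' left' u f'),
    Function.Bijective (IsTwoPullback.reindex (S.tightDiscOpfib small).discOpfib
      sq.toIsTwoPullback sq'.toIsTwoPullback)
  exists_classifies : ∀ {E B : K} (p : E ⟶ B), S.Small p → ∃ f : B ⟶ Ω, Classifies u p f

end Basic

/-! ## Enhanced 2-monads -/

open Enhancement

/-- An enhanced 2-monad: a 2-functor `T` preserving tight maps with 2-natural unit and
multiplication whose components are tight, satisfying the monad laws strictly. -/
structure EnhancedMonad (K : Type u) [Bicategory.{w, v} K] [Bicategory.Strict K]
    [Enhancement K] where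
  T : StrictPseudofunctor K K
  map_tight : ∀ {a b : K} (f : a ⟶ b), IsTight f → IsTight (T.map f)
  unit : ∀ a : K, a ⟶ T.obj a
  unit_tight : ∀ a : K, IsTight (unit a)
  unit_natural : ∀ {a b : K} (f : a ⟶ b), f ≫ unit b = unit a ≫ T.map f
  unit_natural₂ : ∀ {a b : K} {f g : a ⟶ b} (φ : f ⟶ g), φ ▷ unit b ≗ unit a ◁ T.map₂ φ
  mult : ∀ a : K, T.obj (T.obj a) ⟶ T.obj a
  mult_tight : ∀ a : K, IsTight (mult a)
  mult_natural : ∀ {a b : K} (f : a ⟶ b), T.map (T.map f) ≫ mult b = mult a ≫ T.map f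
  mult_natural₂ : ∀ {a b : K} {f g : a ⟶ b} (φ : f ⟶ g),
    T.map₂ (T.map₂ φ) ▷ mult b ≗ mult a ◁ T.map₂ φ
  unit_mult : ∀ a : K, unit (T.obj a) ≫ mult a = 𝟙 (T.obj a)
  map_unit_mult : ∀ a : K, T.map (unit a) ≫ mult a = 𝟙 (T.obj a)
  mult_mult : ∀ a : K, T.map (mult a) ≫ mult a = mult (T.obj a) ≫ mult a

namespace EnhancedMonad

variable {K : Type u} [Bicategory.{w, v} K] [Bicategory.Strict K] [Enhancement K]
  (M : EnhancedMonad K)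

theorem map₂_congr {a b : K} {f g f' g' : a ⟶ b} {φ : f ⟶ g} {ψ : f' ⟶ g'} (h : φ ≗ ψ) :
    M.T.map₂ φ ≗ M.T.map₂ ψ := by
  obtain ⟨rfl, rfl, h⟩ := h
  obtain rfl := eq_of_heq h
  exact CellEq.refl _

theorem map₂_whiskerLeft {a b c : K} (f : a ⟶ b) {g g' : b ⟶ c} (φ : g ⟶ g') :
    M.T.map₂ (f ◁ φ) ≗ M.T.map f ◁ M.T.map₂ φ := by
  rw [M.T.map₂_whisker_left, M.T.mapComp_eq_eqToIso, M.T.mapComp_eq_eqToIso]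
  simp only [eqToIso.hom, eqToIso.inv]
  exact CellEq.conj _ _ _

theorem map₂_whiskerRight {a b c : K} {f f' : a ⟶ b} (φ : f ⟶ f') (g : b ⟶ c) :
    M.T.map₂ (φ ▷ g) ≗ M.T.map₂ φ ▷ M.T.map g := by
  rw [M.T.map₂_whisker_right, M.T.mapComp_eq_eqToIso, M.T.mapComp_eq_eqToIso]
  simp only [eqToIso.hom, eqToIso.inv]
  exact CellEq.conj _ _ _

/-- `α : T A ⟶ A` is a strict `T`-algebra structure which is tight. -/
structure IsAlgebra {A : K} (α : M.T.obj A ⟶ A) : Prop where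
  tight : IsTight α
  unit : M.unit A ≫ α = 𝟙 A
  mult : M.T.map α ≫ α = M.mult A ≫ α

/-- The objects of `Alg_lx(T)`: strict `T`-algebras with tight structure map. -/
structure Alg where
  carrier : K
  str : M.T.obj carrier ⟶ carrier
  isAlgebra : M.IsAlgebra str

variable {M}

/-- Lax `T`-morphisms. -/
structure LaxHom (A B : M.Alg) where
  hom : A.carrier ⟶ B.carrier
  lax : M.T.map hom ≫ B.str ⟶ A.str ≫ hom
  lax_unit : M.unit A.carrier ◁ lax ≗ 𝟙 hom
  lax_mult : M.mult A.carrier ◁ lax ≗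
    M.T.map₂ lax ▷ B.str ≫
      eqToHom (by rw [M.T.map_comp, Strict.assoc]) ≫ M.T.map A.str ◁ lax

namespace LaxHom

variable {A B C D : M.Alg}

theorem ext_cellEq {f g : LaxHom A B} (h : f.hom = g.hom) (h' : f.lax ≗ g.lax) : f = g := by
  obtain ⟨f, lf, _, _⟩ := f
  obtain ⟨g, lg, _, _⟩ := g
  obtain rfl : f = g := h
  obtain rfl : lf = lg := h'.eq
  rfl

/-- A strict `T`-morphism, seen as a lax one. -/
def ofStrict {A B : M.Alg} (f : A.carrier ⟶ B.carrier) (h : M.T.map f ≫ B.str = A.str ≫ f) :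
    LaxHom A B where
  hom := f
  lax := eqToHom h
  lax_unit := by
    rw [whiskerLeft_eqToHom]
    refine (CellEq.eqToHom_left _).trans (CellEq.id_congr ?_)
    rw [h, ← Strict.assoc, A.isAlgebra.unit, Strict.id_comp]
  lax_mult := by
    rw [whiskerLeft_eqToHom, whiskerLeft_eqToHom, M.T.map₂_eqToHom, eqToHom_whiskerRight,
      eqToHom_trans, eqToHom_trans]
    refine (CellEq.eqToHom_left _).trans ((CellEq.id_congr ?_).trans (CellEq.eqToHom_left _).symm)
    rw [M.T.map_comp, Strict.assoc, B.isAlgebra.mult, ← Strict.assoc, ← Strict.assoc,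
      M.mult_natural]

/-- The laxator is an identity. -/
def IsStrict (f : LaxHom A B) : Prop := f.lax ≗ 𝟙 (M.T.map f.hom ≫ B.str)

/-- The laxator is invertible. -/
def IsPseudo (f : LaxHom A B) : Prop := IsIso f.lax

theorem IsStrict.comm {f : LaxHom A B} (h : f.IsStrict) :
    M.T.map f.hom ≫ B.str = A.str ≫ f.hom := h.2.1.symm

theorem id_aux (A : M.Alg) : M.T.map (𝟙 A.carrier) ≫ A.str = A.str ≫ 𝟙 A.carrier := by
  rw [M.T.map_id, Strict.id_comp, Strict.comp_id]

variable (A) in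
/-- The identity lax morphism. -/
def id : LaxHom A A :=
  ofStrict (𝟙 A.carrier) (id_aux A)

theorem comp_aux₁ (f : LaxHom A B) (g : LaxHom B C) :
    M.T.map (f.hom ≫ g.hom) ≫ C.str = M.T.map f.hom ≫ M.T.map g.hom ≫ C.str := by
  rw [M.T.map_comp, Strict.assoc]

/-- The pasting of two laxators, before adjusting the boundary. -/
def pasteLax (f : LaxHom A B) (g : LaxHom B C) :
    M.T.map f.hom ≫ M.T.map g.hom ≫ C.str ⟶ (A.str ≫ f.hom) ≫ g.hom :=
  M.T.map f.hom ◁ g.lax ≫ eqToHom (Strict.assoc _ _ _).symm ≫ f.lax ▷ g.hom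

theorem pasteLax_unit (f : LaxHom A B) (g : LaxHom B C) :
    M.unit A.carrier ◁ pasteLax f g ≗ 𝟙 (f.hom ≫ g.hom) := by
  have h₁ : M.unit A.carrier ◁ M.T.map f.hom ◁ g.lax ≗ 𝟙 (f.hom ≫ g.hom) := by
    refine (CellEq.comp_whiskerLeft _ _ _).symm.trans ?_
    refine (CellEq.whiskerLeft (M.unit_natural f.hom).symm (CellEq.refl _)).trans ?_
    refine (CellEq.comp_whiskerLeft _ _ _).trans ?_
    exact (CellEq.whiskerLeft rfl g.lax_unit).trans (CellEq.of_eq (whiskerLeft_id _ _))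
  have h₂ : M.unit A.carrier ◁ f.lax ▷ g.hom ≗ 𝟙 (f.hom ≫ g.hom) := by
    refine (CellEq.whisker_assoc _ _ _).symm.trans ?_
    exact (CellEq.whiskerRight f.lax_unit rfl).trans (CellEq.of_eq (id_whiskerRight _ _))
  rw [pasteLax, Bicategory.whiskerLeft_comp, Bicategory.whiskerLeft_comp, whiskerLeft_eqToHom]
  refine (CellEq.paste _ rfl h₁ h₂).trans (CellEq.of_eq (by simp))

theorem map₂_pasteLax (f : LaxHom A B) (g : LaxHom B C) :
    M.T.map₂ (pasteLax f g) ▷ C.str ≗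
      (M.T.map (M.T.map f.hom) ◁ M.T.map₂ g.lax ▷ C.str) ≫
        eqToHom (by simp only [M.T.map_comp, Strict.assoc]) ≫
          M.T.map₂ f.lax ▷ (M.T.map g.hom ≫ C.str) := by
  rw [pasteLax, M.T.map₂_comp, M.T.map₂_comp, M.T.map₂_eqToHom, Bicategory.comp_whiskerRight,
    Bicategory.comp_whiskerRight, eqToHom_whiskerRight]
  refine CellEq.paste _ _ ?_ ?_
  · refine (CellEq.whiskerRight (M.map₂_whiskerLeft _ _) rfl).trans ?_
    exact CellEq.whisker_assoc _ _ _
  · refine (CellEq.whiskerRight (M.map₂_whiskerRight _ _) rfl).trans ?_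
    exact (CellEq.whiskerRight_comp _ _ _).symm

theorem pasteLax_exchange (f : LaxHom A B) (g : LaxHom B C) :
    (M.T.map (M.T.map f.hom) ≫ M.T.map B.str) ◁ g.lax ≫
      eqToHom (by simp only [M.T.map_comp, Strict.assoc]) ≫ M.T.map₂ f.lax ▷ (B.str ≫ g.hom) ≗
    M.T.map₂ f.lax ▷ (M.T.map g.hom ≫ C.str) ≫
      eqToHom (by simp only [M.T.map_comp, Strict.assoc]) ≫
        (M.T.map A.str ≫ M.T.map f.hom) ◁ g.lax := by
  have h := whisker_exchange (M.T.map₂ f.lax) g.lax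
  refine (CellEq.paste _ rfl (CellEq.whiskerLeft (M.T.map_comp _ _).symm (CellEq.refl _))
    (CellEq.refl _)).trans ?_
  refine CellEq.trans ?_ (CellEq.paste rfl _ (CellEq.refl _)
    (CellEq.whiskerLeft (M.T.map_comp _ _) (CellEq.refl _)))
  simp only [eqToHom_refl, Category.id_comp]
  exact CellEq.of_eq h

theorem pasteLax_mult (f : LaxHom A B) (g : LaxHom B C) :
    M.mult A.carrier ◁ pasteLax f g ≗
      M.T.map₂ (pasteLax f g) ▷ C.str ≫
        eqToHom (by simp only [M.T.map_comp, Strict.assoc]) ≫ M.T.map A.str ◁ pasteLax f g := by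
  have h₁ : M.mult A.carrier ◁ M.T.map f.hom ◁ g.lax ≗
      (M.T.map (M.T.map f.hom) ◁ M.T.map₂ g.lax ▷ C.str) ≫
        eqToHom (by simp only [M.T.map_comp, Strict.assoc]) ≫
          (M.T.map (M.T.map f.hom) ≫ M.T.map B.str) ◁ g.lax := by
    refine (CellEq.comp_whiskerLeft _ _ _).symm.trans ?_
    refine (CellEq.whiskerLeft (M.mult_natural f.hom).symm (CellEq.refl _)).trans ?_
    refine (CellEq.comp_whiskerLeft _ _ _).trans ?_
    refine (CellEq.whiskerLeft rfl g.lax_mult).trans ?_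
    rw [Bicategory.whiskerLeft_comp, Bicategory.whiskerLeft_comp, whiskerLeft_eqToHom]
    exact CellEq.paste _ _ (CellEq.refl _) (CellEq.comp_whiskerLeft _ _ _).symm
  have h₂ : M.mult A.carrier ◁ f.lax ▷ g.hom ≗
      M.T.map₂ f.lax ▷ (B.str ≫ g.hom) ≫
        eqToHom (by simp only [M.T.map_comp, Strict.assoc]) ≫
          M.T.map A.str ◁ f.lax ▷ g.hom := by
    refine (CellEq.whisker_assoc _ _ _).symm.trans ?_
    refine (CellEq.whiskerRight f.lax_mult rfl).trans ?_
    rw [Bicategory.comp_whiskerRight, Bicategory.comp_whiskerRight, eqToHom_whiskerRight]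
    exact CellEq.paste _ _ (CellEq.whiskerRight_comp _ _ _).symm (CellEq.whisker_assoc _ _ _)
  have hL : M.mult A.carrier ◁ pasteLax f g = M.mult A.carrier ◁ M.T.map f.hom ◁ g.lax ≫
      eqToHom (by simp only [Strict.assoc]) ≫ M.mult A.carrier ◁ f.lax ▷ g.hom := by
    rw [pasteLax, Bicategory.whiskerLeft_comp, Bicategory.whiskerLeft_comp, whiskerLeft_eqToHom]
  have hL' := (CellEq.of_eq hL).trans
    (CellEq.paste _ (by simp only [M.T.map_comp, Strict.assoc]) h₁ h₂)
  have hR : M.T.map A.str ◁ pasteLax f g ≗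
      (M.T.map A.str ≫ M.T.map f.hom) ◁ g.lax ≫
        eqToHom (by simp only [Strict.assoc]) ≫ M.T.map A.str ◁ f.lax ▷ g.hom := by
    rw [pasteLax, Bicategory.whiskerLeft_comp, Bicategory.whiskerLeft_comp, whiskerLeft_eqToHom]
    exact CellEq.paste _ _ (CellEq.comp_whiskerLeft _ _ _).symm (CellEq.refl _)
  refine hL'.trans (CellEq.trans ?_ (CellEq.paste (by simp only [M.T.map_comp, Strict.assoc]) _
    (map₂_pasteLax f g).symm hR.symm))
  have hmid := pasteLax_exchange f g
  have key := (CellEq.refl (M.T.map (M.T.map f.hom) ◁ M.T.map₂ g.lax ▷ C.str)).paste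
    (by simp only [M.T.map_comp, Strict.assoc]) (by simp only [M.T.map_comp, Strict.assoc])
    (hmid.paste (by simp only [M.T.map_comp, Strict.assoc]) (by simp only [Strict.assoc])
      (CellEq.refl (M.T.map A.str ◁ f.lax ▷ g.hom)))
  simpa only [Category.assoc] using key

/-- Composition of lax morphisms, with the pasted laxator. -/
def comp (f : LaxHom A B) (g : LaxHom B C) : LaxHom A C where
  hom := f.hom ≫ g.hom
  lax := eqToHom (comp_aux₁ f g) ≫ pasteLax f g ≫ eqToHom (Strict.assoc _ _ _)
  lax_unit := (CellEq.whiskerLeft rfl (CellEq.conj _ _ _)).trans (pasteLax_unit f g)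
  lax_mult := by
    refine (CellEq.whiskerLeft rfl (CellEq.conj _ _ _)).trans ((pasteLax_mult f g).trans ?_)
    exact CellEq.paste _ _ (CellEq.whiskerRight (M.map₂_congr (CellEq.conj _ _ _).symm) rfl)
      (CellEq.whiskerLeft rfl (CellEq.conj _ _ _).symm)

theorem comp_lax (f : LaxHom A B) (g : LaxHom B C) : (f.comp g).lax ≗ pasteLax f g :=
  CellEq.conj _ _ _

theorem id_lax (A : M.Alg) : (id A).lax ≗ 𝟙 A.str :=
  (CellEq.eqToHom_left (id_aux A)).trans (CellEq.id_congr ((congrArg (· ≫ A.str) (M.T.map_id _)).trans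
    (Strict.id_comp _)))

theorem id_comp_lax (f : LaxHom A B) : ((id A).comp f).lax ≗ f.lax := by
  refine (comp_lax _ _).trans ?_
  have h₁ : M.T.map (id A).hom ◁ f.lax ≗ f.lax :=
    (CellEq.whiskerLeft (M.T.map_id _) (CellEq.refl _)).trans (CellEq.id_whiskerLeft _)
  have h₂ : (id A).lax ▷ f.hom ≗ 𝟙 (A.str ≫ f.hom) :=
    (CellEq.whiskerRight (id_lax A) rfl).trans (CellEq.of_eq (id_whiskerRight _ _))
  exact (h₁.paste _ rfl h₂).trans (CellEq.of_eq (by simp))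

theorem comp_id_lax (f : LaxHom A B) : (f.comp (id B)).lax ≗ f.lax := by
  refine (comp_lax _ _).trans ?_
  have h₁ : M.T.map f.hom ◁ (id B).lax ≗ 𝟙 (M.T.map f.hom ≫ B.str) :=
    (CellEq.whiskerLeft rfl (id_lax B)).trans (CellEq.of_eq (whiskerLeft_id _ _))
  have h₂ : f.lax ▷ (id B).hom ≗ f.lax := CellEq.whiskerRight_id _
  exact (h₁.paste _ rfl h₂).trans (CellEq.of_eq (by simp))

theorem assoc_lax (f : LaxHom A B) (g : LaxHom B C) (h : LaxHom C D) :
    ((f.comp g).comp h).lax ≗ (f.comp (g.comp h)).lax := by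
  refine (comp_lax _ _).trans (CellEq.trans ?_ (comp_lax _ _).symm)
  have l : (f.comp g).lax ▷ h.hom ≗
      (M.T.map f.hom ◁ g.lax ▷ h.hom) ≫ eqToHom (by simp only [Strict.assoc]) ≫
        f.lax ▷ (g.hom ≫ h.hom) := by
    refine (CellEq.whiskerRight (comp_lax _ _) rfl).trans ?_
    rw [pasteLax, Bicategory.comp_whiskerRight, Bicategory.comp_whiskerRight, eqToHom_whiskerRight]
    exact CellEq.paste _ _ (CellEq.whisker_assoc _ _ _) (CellEq.whiskerRight_comp _ _ _).symm
  have r : M.T.map f.hom ◁ (g.comp h).lax ≗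
      ((M.T.map f.hom ≫ M.T.map g.hom) ◁ h.lax) ≫ eqToHom (by simp only [Strict.assoc]) ≫
        M.T.map f.hom ◁ g.lax ▷ h.hom := by
    refine (CellEq.whiskerLeft rfl (comp_lax _ _)).trans ?_
    rw [pasteLax, Bicategory.whiskerLeft_comp, Bicategory.whiskerLeft_comp, whiskerLeft_eqToHom]
    exact CellEq.paste _ _ (CellEq.comp_whiskerLeft _ _ _).symm (CellEq.refl _)
  have s : M.T.map (f.comp g).hom ◁ h.lax ≗ (M.T.map f.hom ≫ M.T.map g.hom) ◁ h.lax :=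
    CellEq.whiskerLeft (M.T.map_comp _ _) (CellEq.refl _)
  refine (CellEq.paste _ (by simp only [Strict.assoc]) s l).trans
    (CellEq.trans ?_ (CellEq.paste (by simp only [Strict.assoc]; rfl) _ r.symm (CellEq.refl _)))
  simp only [Category.assoc]
  exact CellEq.refl _

end LaxHom

/-- `T`-2-morphisms between lax morphisms. -/
@[ext]
structure LaxCell {A B : M.Alg} (f g : LaxHom A B) where
  cell : f.hom ⟶ g.hom
  comm : f.lax ≫ A.str ◁ cell = M.T.map₂ cell ▷ B.str ≫ g.lax

instance (A B : M.Alg) : Category (LaxHom A B) where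
  Hom f g := LaxCell f g
  id f := ⟨𝟙 f.hom, by simp⟩
  comp σ τ := ⟨σ.cell ≫ τ.cell, by
    rw [Bicategory.whiskerLeft_comp, ← Category.assoc, σ.comm, Category.assoc, τ.comm,
      M.T.map₂_comp, Bicategory.comp_whiskerRight, Category.assoc]⟩
  id_comp σ := LaxCell.ext (Category.id_comp _)
  comp_id σ := LaxCell.ext (Category.comp_id _)
  assoc σ τ ρ := LaxCell.ext (Category.assoc _ _ _)

namespace LaxCell

variable {A B C D : M.Alg}

theorem hom_ext {f g : LaxHom A B} {σ τ : f ⟶ g} (h : σ.cell = τ.cell) : σ = τ := LaxCell.ext h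

theorem pasteLax_whiskerLeft (f : LaxHom A B) {g h : LaxHom B C} (σ : g ⟶ h) :
    f.pasteLax g ≫ (A.str ≫ f.hom) ◁ σ.cell =
      (M.T.map f.hom ◁ M.T.map₂ σ.cell ▷ C.str) ≫ f.pasteLax h := by
  have e : eqToHom (Strict.assoc _ _ _).symm ≫ (M.T.map f.hom ≫ B.str) ◁ σ.cell =
      M.T.map f.hom ◁ B.str ◁ σ.cell ≫ eqToHom (Strict.assoc _ _ _).symm :=
    ((CellEq.eqToHom_comp _ _).trans ((CellEq.comp_whiskerLeft _ _ _).trans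
      (CellEq.comp_eqToHom _ _).symm)).eq
  simp only [LaxHom.pasteLax, Category.assoc]
  rw [← whisker_exchange, reassoc_of% e,
    ← Bicategory.whiskerLeft_comp_assoc, σ.comm, Bicategory.whiskerLeft_comp_assoc]

theorem pasteLax_whiskerRight {f g : LaxHom A B} (σ : f ⟶ g) (h : LaxHom B C) :
    f.pasteLax h ≫ (A.str ◁ σ.cell) ▷ h.hom =
      M.T.map₂ σ.cell ▷ (M.T.map h.hom ≫ C.str) ≫ g.pasteLax h := by
  have e : eqToHom (Strict.assoc _ _ _).symm ≫ M.T.map₂ σ.cell ▷ B.str ▷ h.hom =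
      M.T.map₂ σ.cell ▷ (B.str ≫ h.hom) ≫ eqToHom (Strict.assoc _ _ _).symm :=
    ((CellEq.eqToHom_comp _ _).trans ((CellEq.whiskerRight_comp _ _ _).symm.trans
      (CellEq.comp_eqToHom _ _).symm)).eq
  simp only [LaxHom.pasteLax, Category.assoc]
  rw [← Bicategory.comp_whiskerRight, σ.comm, Bicategory.comp_whiskerRight,
    reassoc_of% e, whisker_exchange_assoc]

/-- Whiskering on the left. -/
def whiskerLeft (f : LaxHom A B) {g h : LaxHom B C} (σ : g ⟶ h) : f.comp g ⟶ f.comp h where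
  cell := f.hom ◁ σ.cell
  comm := by
    refine CellEq.eq (((LaxHom.comp_lax f g).comp (CellEq.comp_whiskerLeft _ _ _).symm).trans
      ((CellEq.of_eq (pasteLax_whiskerLeft f σ)).trans
        (CellEq.comp ?_ (LaxHom.comp_lax f h).symm)))
    exact (CellEq.whisker_assoc _ _ _).symm.trans
      (CellEq.whiskerRight (M.map₂_whiskerLeft _ _).symm rfl)

/-- Whiskering on the right. -/
def whiskerRight {f g : LaxHom A B} (σ : f ⟶ g) (h : LaxHom B C) : f.comp h ⟶ g.comp h where
  cell := σ.cell ▷ h.hom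
  comm := by
    refine CellEq.eq (((LaxHom.comp_lax f h).comp (CellEq.whisker_assoc _ _ _).symm).trans
      ((CellEq.of_eq (pasteLax_whiskerRight σ h)).trans
        (CellEq.comp ?_ (LaxHom.comp_lax g h).symm)))
    exact (CellEq.whiskerRight_comp _ _ _).trans
      (CellEq.whiskerRight (M.map₂_whiskerRight _ _).symm rfl)

theorem comm_of_id {f g : LaxHom A B} (h : f.lax ≗ g.lax) {φ : f.hom ⟶ g.hom}
    (hφ : φ ≗ 𝟙 f.hom) : f.lax ≫ A.str ◁ φ = M.T.map₂ φ ▷ B.str ≫ g.lax := by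
  have h₁ : A.str ◁ φ ≗ 𝟙 (A.str ≫ f.hom) :=
    (CellEq.whiskerLeft rfl hφ).trans (CellEq.of_eq (whiskerLeft_id _ _))
  have h₂ : M.T.map₂ φ ▷ B.str ≗ 𝟙 (M.T.map g.hom ≫ B.str) :=
    (CellEq.whiskerRight (M.map₂_congr (hφ.trans (CellEq.id_congr hφ.2.1.symm))) rfl).trans
      (CellEq.of_eq (by simp))
  refine CellEq.eq (CellEq.trans ((CellEq.refl f.lax).comp h₁) ?_)
  refine CellEq.trans ?_ (h₂.comp (CellEq.refl g.lax)).symm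
  rw [Category.comp_id, Category.id_comp]
  exact h

/-- The isomorphism of lax morphisms underlain by an identity 2-cell. -/
def isoOfId {f g : LaxHom A B} (h : f.lax ≗ g.lax) (φ : f.hom ≅ g.hom)
    (hφ : φ.hom ≗ 𝟙 f.hom) (hφ' : φ.inv ≗ 𝟙 g.hom) : f ≅ g where
  hom := ⟨φ.hom, comm_of_id h hφ⟩
  inv := ⟨φ.inv, comm_of_id h.symm hφ'⟩
  hom_inv_id := hom_ext φ.hom_inv_id
  inv_hom_id := hom_ext φ.inv_hom_id

end LaxCell

/-- The 2-category `Alg_lx(T)` of strict `T`-algebras with tight structure map, lax `T`-morphisms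
and `T`-2-morphisms. -/
instance algBicategory : Bicategory M.Alg where
  Hom A B := LaxHom A B
  id A := LaxHom.id A
  comp f g := f.comp g
  homCategory A B := inferInstance
  whiskerLeft f _ _ σ := LaxCell.whiskerLeft f σ
  whiskerRight σ h := LaxCell.whiskerRight σ h
  associator f g h := LaxCell.isoOfId (f.assoc_lax g h) (α_ f.hom g.hom h.hom)
    (CellEq.eqToIso_hom_id (Strict.associator_eqToIso _ _ _))
    (CellEq.eqToIso_inv_id (Strict.associator_eqToIso _ _ _))
  leftUnitor f := LaxCell.isoOfId f.id_comp_lax (λ_ f.hom)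
    (CellEq.eqToIso_hom_id (Strict.leftUnitor_eqToIso _))
    (CellEq.eqToIso_inv_id (Strict.leftUnitor_eqToIso _))
  rightUnitor f := LaxCell.isoOfId f.comp_id_lax (ρ_ f.hom)
    (CellEq.eqToIso_hom_id (Strict.rightUnitor_eqToIso _))
    (CellEq.eqToIso_inv_id (Strict.rightUnitor_eqToIso _))
  whiskerLeft_id f g := LaxCell.hom_ext (Bicategory.whiskerLeft_id _ _)
  whiskerLeft_comp f _ _ _ σ τ := LaxCell.hom_ext (Bicategory.whiskerLeft_comp _ _ _)
  id_whiskerLeft σ := LaxCell.hom_ext (Bicategory.id_whiskerLeft _)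
  comp_whiskerLeft f g _ _ σ := LaxCell.hom_ext (Bicategory.comp_whiskerLeft _ _ _)
  id_whiskerRight f g := LaxCell.hom_ext (Bicategory.id_whiskerRight _ _)
  comp_whiskerRight σ τ h := LaxCell.hom_ext (Bicategory.comp_whiskerRight _ _ _)
  whiskerRight_id σ := LaxCell.hom_ext (Bicategory.whiskerRight_id _)
  whiskerRight_comp σ g h := LaxCell.hom_ext (Bicategory.whiskerRight_comp _ _ _)
  whisker_assoc f _ _ σ h := LaxCell.hom_ext (Bicategory.whisker_assoc _ _ _)
  whisker_exchange σ τ := LaxCell.hom_ext (Bicategory.whisker_exchange _ _)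
  pentagon f g h i := LaxCell.hom_ext (Bicategory.pentagon _ _ _ _)
  triangle f g := LaxCell.hom_ext (Bicategory.triangle _ _)

theorem LaxCell.eqToIso_cell {A B : M.Alg} {f g : A ⟶ B} (h : f = g) :
    LaxCell.cell (eqToIso h).hom =
      (eqToIso (congrArg (LaxHom.hom (A := A) (B := B)) h)).hom := by
  subst h
  rfl

instance algStrict : Bicategory.Strict M.Alg where
  id_comp f := LaxHom.ext_cellEq (Strict.id_comp _) (LaxHom.id_comp_lax f)
  comp_id f := LaxHom.ext_cellEq (Strict.comp_id _) (LaxHom.comp_id_lax f)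
  assoc f g h := LaxHom.ext_cellEq (Strict.assoc _ _ _) (LaxHom.assoc_lax f g h)
  leftUnitor_eqToIso f := Iso.ext (LaxCell.hom_ext (Eq.trans
    (congrArg Iso.hom (Strict.leftUnitor_eqToIso _))
    (LaxCell.eqToIso_cell (f := 𝟙 _ ≫ f) (g := f) (LaxHom.ext_cellEq
      (Strict.id_comp _) (LaxHom.id_comp_lax f))).symm))
  rightUnitor_eqToIso f := Iso.ext (LaxCell.hom_ext (Eq.trans
    (congrArg Iso.hom (Strict.rightUnitor_eqToIso _))
    (LaxCell.eqToIso_cell (f := f ≫ 𝟙 _) (g := f) (LaxHom.ext_cellEq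
      (Strict.comp_id _) (LaxHom.comp_id_lax f))).symm))
  associator_eqToIso f g h := Iso.ext (LaxCell.hom_ext (Eq.trans
    (congrArg Iso.hom (Strict.associator_eqToIso _ _ _))
    (LaxCell.eqToIso_cell (f := (f ≫ g) ≫ h) (g := f ≫ g ≫ h) (LaxHom.ext_cellEq
      (Strict.assoc _ _ _) (LaxHom.assoc_lax f g h))).symm))

theorem LaxHom.isStrict_comp {A B C : M.Alg} {f : LaxHom A B} {g : LaxHom B C}
    (hf : f.IsStrict) (hg : g.IsStrict) : (f.comp g).IsStrict := by
  have h₁ : M.T.map f.hom ◁ g.lax ≗ 𝟙 (M.T.map f.hom ≫ M.T.map g.hom ≫ C.str) :=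
    (CellEq.whiskerLeft rfl hg).trans (CellEq.of_eq (whiskerLeft_id _ _))
  have h₂ : f.lax ▷ g.hom ≗ 𝟙 (M.T.map f.hom ≫ M.T.map g.hom ≫ C.str) :=
    (CellEq.whiskerRight hf rfl).trans ((CellEq.of_eq (id_whiskerRight _ _)).trans
      (CellEq.id_congr (by rw [Strict.assoc, hg.comm])))
  refine (LaxHom.comp_lax f g).trans ((h₁.paste _ rfl h₂).trans ?_)
  refine (CellEq.of_eq (by simp)).trans (CellEq.id_congr (LaxHom.comp_aux₁ f g).symm)

/-- The tight 1-cells of `Alg_lx(T)` are the strict morphisms which are tight in `K`. -/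
instance algEnhancement : Enhancement M.Alg where
  IsTight {A B} f := LaxHom.IsStrict (A := A) (B := B) f ∧ IsTight (LaxHom.hom f)
  id_tight A := ⟨CellEq.eqToHom_left (LaxHom.id_aux A), Enhancement.id_tight _⟩
  comp_tight _ _ hf hg := ⟨LaxHom.isStrict_comp hf.1 hg.1,
    Enhancement.comp_tight _ _ hf.2 hg.2⟩

theorem isStrict_of_isTight {A B : M.Alg} {f : A ⟶ B} (h : IsTight f) :
    LaxHom.IsStrict (A := A) (B := B) f := h.1

/-! ## Cartesianity and the hypotheses on `T` -/

/-- The `T`-cartesianity defect `T E ⟶ β^* E` of a strict `T`-morphism `p : (E, η) ⟶ (B, β)`: the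
comparison, with components `η` and `T p`, into a pullback of `p` along `β`. -/
noncomputable def cartesianityDefect {E B : M.Alg} (p : LaxHom E B) (hp : p.IsStrict) {P : K}
    {top : P ⟶ E.carrier} {left : P ⟶ M.T.obj B.carrier}
    (sq : IsTwoPullback top left p.hom B.str) : M.T.obj E.carrier ⟶ P :=
  sq.lift E.str (M.T.map p.hom) hp.comm.symm

/-- A strict `T`-morphism `p : (E, η) ⟶ (B, β)` is `T`-cartesian when the pullback of `p` along `β`
exists and the `T`-cartesianity defect is a split equivalence. -/
def IsTCartesian {E B : M.Alg} (p : LaxHom E B) (hp : p.IsStrict) : Prop :=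
  ∃ (P : K) (top : P ⟶ E.carrier) (left : P ⟶ M.T.obj B.carrier)
    (sq : IsTwoPullback top left p.hom B.str), IsSplitEquivalence (cartesianityDefect p hp sq)

/-- The hypotheses on an enhanced 2-monad with respect to a 2-classifier `u : Ω' ⟶ Ω`:
`T u` is small, with tight classifying map `ω` (exhibited by `ω'`), `T` preserves pullbacks of `u`,
the unit and the multiplication are cartesian at `u`, and `(Ω, ω)` is a strict `T`-algebra. -/
structure LiftingHypotheses (S : SmallClass K) (M : EnhancedMonad K) {Ω' Ω : K} (u : Ω' ⟶ Ω)
    (ω' : M.T.obj Ω' ⟶ Ω') (ω : M.T.obj Ω ⟶ Ω) : Prop where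
  small_map : S.Small (M.T.map u)
  classifies : IsLeftTightPullback ω' (M.T.map u) u ω
  preserves_pullback : ∀ {P B : K} {top : P ⟶ Ω'} {left : P ⟶ B} {f : B ⟶ Ω},
    IsLeftTightPullback top left u f →
      IsTwoPullback (M.T.map top) (M.T.map left) (M.T.map u) (M.T.map f)
  unit_cartesian : IsTwoPullback (M.unit Ω') u (M.T.map u) (M.unit Ω)
  mult_cartesian : IsTwoPullback (M.mult Ω') (M.T.map (M.T.map u)) (M.T.map u) (M.mult Ω)
  tight : IsTight ω
  unit : M.unit Ω ≫ ω = 𝟙 Ω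
  mult : M.T.map ω ≫ ω = M.mult Ω ≫ ω

namespace LiftingHypotheses

variable {S : SmallClass K} {Ω' Ω : K} {u : Ω' ⟶ Ω} {ω' : M.T.obj Ω' ⟶ Ω'}
  {ω : M.T.obj Ω ⟶ Ω}

/-- The `T`-algebra `(Ω, ω)`. -/
def algΩ (h : LiftingHypotheses S M u ω' ω) : M.Alg := ⟨Ω, ω, h.tight, h.unit, h.mult⟩

/-- The strict `T`-morphism `u : (Ω', ω') ⟶ (Ω, ω)`. -/
def algU (h : LiftingHypotheses S M u ω' ω) (h' : M.IsAlgebra ω') :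
    (⟨Ω', ω', h'⟩ : M.Alg) ⟶ h.algΩ :=
  LaxHom.ofStrict u h.classifies.w.symm

end LiftingHypotheses

end EnhancedMonad

/-! By the universal property of `u`, 2-cells `f ⟶ f'` between maps `B ⟶ Ω` amount to maps over
`B` from the pullback of `u` along `f` to its pullback along `f'`: transport along `u` turns such a
2-cell into a lift to `Ω'` of the composite of `f'` with the projection of the first pullback.

Let `g : B ⟶ Ω` classify `p` in `K`. Applying `T` to the classifying square and pasting with the
square of `ω` shows that `Tp` is classified by `Tg ≫ ω`, while the pullback of `p` along `β` is
classified by `β ≫ g`. The defect `δ_p` is a map over `TB` between these pullbacks, so it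
corresponds to a 2-cell `Tg ≫ ω ⟶ β ≫ g`. This is the laxator of `dp`; its laws hold because lifts
along a discrete opfibration are unique, and it is invertible exactly when `δ_p` is. Over a discrete
opfibration a split equivalence is already invertible.

The algebra laws for `ω'` hold because lifts through the pullbacks concerned are unique: any two
differ by a 2-cell, which is trivial on the point `1 ⟶ Ω'` provided by the small map `id₁`, and
every element of `Ω'` receives a 2-cell from that point. -/

/-- A 2-cell bundled with its source and target. Since composition of 1-cells is only
propositionally associative and unital, the laws of a 2-category are equations between bundled
2-cells, and `CellEq` is equality of bundled 2-cells. -/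
structure TwoCell {K : Type u} [Bicategory.{w, v} K] (a b : K) where of ::
  {src : a ⟶ b}
  {tgt : a ⟶ b}
  hom : src ⟶ tgt

namespace TwoCell

variable {K : Type u} [Bicategory.{w, v} K] {a b c d : K}

theorem of_eq_of {f g f' g' : a ⟶ b} {φ : f ⟶ g} {ψ : f' ⟶ g'} : of φ = of ψ ↔ φ ≗ ψ := by
  rw [of.injEq, CellEq]

theorem of_injective {f g : a ⟶ b} : Function.Injective (of : (f ⟶ g) → TwoCell a b) :=
  fun _ _ h => (of_eq_of.1 h).eq

theorem exists_of_eq (X : TwoCell a b) {f g : a ⟶ b} (hf : X.src = f) (hg : X.tgt = g) :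
    ∃ φ : f ⟶ g, of φ = X := by
  subst hf hg
  exact ⟨X.hom, rfl⟩

theorem of_eqToHom_comp {f g h : a ⟶ b} (e : f = g) (φ : g ⟶ h) : of (eqToHom e ≫ φ) = of φ :=
  of_eq_of.2 (CellEq.eqToHom_comp e φ)

/-- Left whiskering of bundled 2-cells. -/
@[simps]
def whiskerLeft (f : a ⟶ b) (X : TwoCell b c) : TwoCell a c := of (f ◁ X.hom)

/-- Right whiskering of bundled 2-cells. -/
@[simps]
def whiskerRight (X : TwoCell a b) (g : b ⟶ c) : TwoCell a c := of (X.hom ▷ g)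

infixr:81 " ◁₂ " => TwoCell.whiskerLeft

infixl:81 " ▷₂ " => TwoCell.whiskerRight

theorem whiskerLeft_of_id (f : a ⟶ b) (g : b ⟶ c) : f ◁₂ of (𝟙 g) = of (𝟙 (f ≫ g)) :=
  congrArg of (Bicategory.whiskerLeft_id f g)

theorem of_id_whiskerRight (f : a ⟶ b) (g : b ⟶ c) : of (𝟙 f) ▷₂ g = of (𝟙 (f ≫ g)) :=
  congrArg of (Bicategory.id_whiskerRight f g)

/-- `IsComp X Y Z` means that `Z` is the vertical composite of `X` followed by `Y`. Vertical
composition is treated as a relation because it is only defined when `X.tgt = Y.src`. -/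
inductive IsComp : TwoCell a b → TwoCell a b → TwoCell a b → Prop
  | mk {f g h : a ⟶ b} (φ : f ⟶ g) (ψ : g ⟶ h) : IsComp (of φ) (of ψ) (of (φ ≫ ψ))

theorem exists_isComp {X Y : TwoCell a b} (h : X.tgt = Y.src) : ∃ Z, IsComp X Y Z := by
  obtain ⟨φ⟩ := X
  obtain ⟨ψ⟩ := Y
  subst h
  exact ⟨_, .mk φ ψ⟩

theorem isComp_of_iff {f g f' h : a ⟶ b} {φ : f ⟶ g} {ψ : f' ⟶ h} {Z : TwoCell a b} :
    IsComp (of φ) (of ψ) Z ↔ ∃ e : g = f', Z = of (φ ≫ eqToHom e ≫ ψ) := by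
  constructor
  · rintro ⟨⟩
    exact ⟨rfl, by rw [eqToHom_refl, Category.id_comp]⟩
  · rintro ⟨rfl, rfl⟩
    rw [eqToHom_refl, Category.id_comp]
    exact .mk φ ψ

theorem isComp_id_left (X : TwoCell a b) : IsComp (of (𝟙 X.src)) X X := by
  simpa only [Category.id_comp] using IsComp.mk (𝟙 X.src) X.hom

theorem isComp_id_right (X : TwoCell a b) : IsComp X (of (𝟙 X.tgt)) X := by
  simpa only [Category.comp_id] using IsComp.mk X.hom (𝟙 X.tgt)

namespace IsComp

variable {X Y Z : TwoCell a b}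

theorem src_eq (h : IsComp X Y Z) : Z.src = X.src := by
  cases h
  rfl

theorem tgt_eq (h : IsComp X Y Z) : Z.tgt = Y.tgt := by
  cases h
  rfl

theorem tgt_eq_src (h : IsComp X Y Z) : X.tgt = Y.src := by
  cases h
  rfl

theorem unique {Z' : TwoCell a b} (h : IsComp X Y Z) (h' : IsComp X Y Z') : Z = Z' := by
  cases h
  cases h'
  rfl

theorem eq_right {f : a ⟶ b} (h : IsComp (of (𝟙 f)) Y Z) : Z = Y := by
  obtain rfl : f = Y.src := h.tgt_eq_src
  exact h.unique (isComp_id_left Y)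

theorem eq_left {f : a ⟶ b} (h : IsComp X (of (𝟙 f)) Z) : Z = X := by
  obtain rfl : X.tgt = f := h.tgt_eq_src
  exact h.unique (isComp_id_right X)

theorem whiskerLeft (f : c ⟶ a) (h : IsComp X Y Z) : IsComp (f ◁₂ X) (f ◁₂ Y) (f ◁₂ Z) := by
  cases h with | mk φ ψ => ?_
  simpa only [TwoCell.whiskerLeft, Bicategory.whiskerLeft_comp] using IsComp.mk (f ◁ φ) (f ◁ ψ)

theorem whiskerRight (h : IsComp X Y Z) (g : b ⟶ c) : IsComp (X ▷₂ g) (Y ▷₂ g) (Z ▷₂ g) := by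
  cases h with | mk φ ψ => ?_
  simpa only [TwoCell.whiskerRight, Bicategory.comp_whiskerRight] using IsComp.mk (φ ▷ g) (ψ ▷ g)

end IsComp

theorem interchange (X : TwoCell a b) (Y : TwoCell b c) :
    ∃ Z, IsComp (X.src ◁₂ Y) (X ▷₂ Y.tgt) Z ∧ IsComp (X ▷₂ Y.src) (X.tgt ◁₂ Y) Z :=
  ⟨_, .mk (X.src ◁ Y.hom) (X.hom ▷ Y.tgt),
    whisker_exchange X.hom Y.hom ▸ .mk (X.hom ▷ Y.src) (X.tgt ◁ Y.hom)⟩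

section Strict

variable [Bicategory.Strict K]

theorem whiskerLeft_whiskerLeft (f : a ⟶ b) (g : b ⟶ c) (X : TwoCell c d) :
    f ◁₂ g ◁₂ X = (f ≫ g) ◁₂ X :=
  (of_eq_of.2 (CellEq.comp_whiskerLeft f g X.hom)).symm

theorem whiskerRight_whiskerRight (X : TwoCell a b) (g : b ⟶ c) (h : c ⟶ d) :
    X ▷₂ g ▷₂ h = X ▷₂ (g ≫ h) :=
  (of_eq_of.2 (CellEq.whiskerRight_comp X.hom g h)).symm

theorem whiskerLeft_whiskerRight (f : a ⟶ b) (X : TwoCell b c) (h : c ⟶ d) :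
    (f ◁₂ X) ▷₂ h = f ◁₂ X ▷₂ h :=
  of_eq_of.2 (CellEq.whisker_assoc f X.hom h)

protected theorem id_whiskerLeft (X : TwoCell a b) : 𝟙 a ◁₂ X = X :=
  of_eq_of.2 (CellEq.id_whiskerLeft X.hom)

protected theorem whiskerRight_id (X : TwoCell a b) : X ▷₂ 𝟙 b = X :=
  of_eq_of.2 (CellEq.whiskerRight_id X.hom)

variable [Enhancement K] (M : EnhancedMonad K)

/-- The action of the 2-monad on bundled 2-cells. -/
@[simps]
def map (X : TwoCell a b) : TwoCell (M.T.obj a) (M.T.obj b) := of (M.T.map₂ X.hom)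

theorem map_whiskerLeft (f : a ⟶ b) (X : TwoCell b c) :
    (f ◁₂ X).map M = M.T.map f ◁₂ X.map M :=
  of_eq_of.2 (M.map₂_whiskerLeft f X.hom)

theorem map_whiskerRight (X : TwoCell a b) (g : b ⟶ c) :
    (X ▷₂ g).map M = X.map M ▷₂ M.T.map g :=
  of_eq_of.2 (M.map₂_whiskerRight X.hom g)

end Strict

end TwoCell

section Transport

variable {K : Type u} [Bicategory.{w, v} K] {X E B : K} {p : E ⟶ B}

open TwoCell

/-- `Φ.Transports p e e'` means that `Φ` lifts along `p` to a 2-cell `e ⟶ e'`. For a discrete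
opfibration `p` this determines `e'`, which is then the codomain `Φ_* e` of the lift. -/
def TwoCell.Transports (p : E ⟶ B) (Φ : TwoCell X B) (e e' : X ⟶ E) : Prop :=
  ∃ Λ : TwoCell X E, Λ.src = e ∧ Λ.tgt = e' ∧ Λ ▷₂ p = Φ

theorem TwoCell.transports_whiskerRight (Λ : TwoCell X E) (p : E ⟶ B) :
    (Λ ▷₂ p).Transports p Λ.src Λ.tgt :=
  ⟨Λ, rfl, rfl, rfl⟩

theorem TwoCell.transports_id (e : X ⟶ E) (p : E ⟶ B) : (of (𝟙 (e ≫ p))).Transports p e e :=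
  ⟨of (𝟙 e), rfl, rfl, of_id_whiskerRight e p⟩

namespace TwoCell.Transports

variable {Φ Ψ Χ : TwoCell X B} {e e' e'' : X ⟶ E}

theorem tgt_eq (h : Φ.Transports p e e') : e' ≫ p = Φ.tgt := by
  obtain ⟨Λ, -, rfl, rfl⟩ := h
  rfl

theorem comp (h : Φ.Transports p e e') (h' : Ψ.Transports p e' e'') (hc : IsComp Φ Ψ Χ) :
    Χ.Transports p e e'' := by
  obtain ⟨Λ, rfl, rfl, rfl⟩ := h
  obtain ⟨Λ', hs, rfl, rfl⟩ := h'
  obtain ⟨Λ'', hΛ''⟩ := exists_isComp hs.symm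
  exact ⟨Λ'', hΛ''.src_eq, hΛ''.tgt_eq, (hΛ''.whiskerRight p).unique hc⟩

variable [Bicategory.Strict K]

theorem whiskerLeft {Y : K} (k : Y ⟶ X) (h : Φ.Transports p e e') :
    (k ◁₂ Φ).Transports p (k ≫ e) (k ≫ e') := by
  obtain ⟨Λ, rfl, rfl, rfl⟩ := h
  exact ⟨k ◁₂ Λ, rfl, rfl, whiskerLeft_whiskerRight k Λ p⟩

theorem whiskerRight {E' B' : K} {t : E ⟶ E'} {f : B ⟶ B'} {p' : E' ⟶ B'}
    (h : Φ.Transports p e e') (w : t ≫ p' = p ≫ f) :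
    (Φ ▷₂ f).Transports p' (e ≫ t) (e' ≫ t) := by
  obtain ⟨Λ, rfl, rfl, rfl⟩ := h
  exact ⟨Λ ▷₂ t, rfl, rfl, by
    rw [whiskerRight_whiskerRight, w, ← whiskerRight_whiskerRight]⟩

theorem map [Enhancement K] (M : EnhancedMonad K) (h : Φ.Transports p e e') :
    (Φ.map M).Transports (M.T.map p) (M.T.map e) (M.T.map e') := by
  obtain ⟨Λ, rfl, rfl, rfl⟩ := h
  exact ⟨Λ.map M, rfl, rfl, (map_whiskerRight M Λ p).symm⟩

end TwoCell.Transports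

namespace IsDiscOpfib

theorem exists_transports (hp : IsDiscOpfib p) {e : X ⟶ E} {Φ : TwoCell X B}
    (h : e ≫ p = Φ.src) : ∃ e', Φ.Transports p e e' := by
  obtain ⟨φ⟩ := Φ
  subst h
  obtain ⟨⟨e', l⟩, hl, -⟩ := hp e _ φ
  exact ⟨e', of l, rfl, rfl, of_eq_of.2 hl⟩

theorem cell_ext (hp : IsDiscOpfib p) {Λ Λ' : TwoCell X E} (hs : Λ.src = Λ'.src)
    (h : Λ ▷₂ p = Λ' ▷₂ p) : Λ = Λ' := by
  obtain @⟨e, e', l⟩ := Λ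
  obtain @⟨e₁, e₁', l'⟩ := Λ'
  obtain rfl : e = e₁ := hs
  exact congrArg (fun l : Σ e' : X ⟶ E, (e ⟶ e') => of l.2)
    ((hp e _ (l ▷ p)).unique (y₁ := ⟨e', l⟩) (y₂ := ⟨e₁', l'⟩) (CellEq.refl _)
      (of_eq_of.1 h.symm))

theorem transports_unique (hp : IsDiscOpfib p) {Φ : TwoCell X B} {e e₁ e₂ : X ⟶ E}
    (h₁ : Φ.Transports p e e₁) (h₂ : Φ.Transports p e e₂) : e₁ = e₂ := by
  obtain ⟨Λ, hs, rfl, hΛ⟩ := h₁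
  obtain ⟨Λ', hs', rfl, hΛ'⟩ := h₂
  exact congrArg tgt (hp.cell_ext (hs.trans hs'.symm) (hΛ.trans hΛ'.symm))

theorem isComp_of_whiskerRight (hp : IsDiscOpfib p) {Λ Λ' Λ'' : TwoCell X E}
    (hs : Λ''.src = Λ.src) (ht : Λ.tgt = Λ'.src)
    (h : IsComp (Λ ▷₂ p) (Λ' ▷₂ p) (Λ'' ▷₂ p)) : IsComp Λ Λ' Λ'' := by
  obtain ⟨Χ, hΧ⟩ := exists_isComp ht
  rwa [hp.cell_ext (hs.trans hΧ.src_eq.symm) (h.unique (hΧ.whiskerRight p))]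

theorem push_eq_iff (hp : IsDiscOpfib p) {e e' : X ⟶ E} {b : X ⟶ B} (φ : e ≫ p ⟶ b) :
    hp.push e φ = e' ↔ (of φ).Transports p e e' := by
  have h : (of φ).Transports p e (hp.push e φ) :=
    ⟨of (hp e b φ).choose.2, rfl, rfl, of_eq_of.2 (hp e b φ).choose_spec.1⟩
  exact ⟨fun h' => h' ▸ h, hp.transports_unique h⟩

end IsDiscOpfib

end Transport

namespace IsTwoPullback

open TwoCell

variable {K : Type u} [Bicategory.{w, v} K] [Bicategory.Strict K] {X P E A B : K}
  {top : P ⟶ E} {left : P ⟶ A} {p : E ⟶ B} {f : A ⟶ B}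

theorem hom_ext (sq : IsTwoPullback top left p f) {h k : X ⟶ P} (h₁ : h ≫ top = k ≫ top)
    (h₂ : h ≫ left = k ≫ left) : h = k :=
  (sq.existsUnique_lift (k ≫ top) (k ≫ left) (by rw [Strict.assoc, Strict.assoc, sq.w])).unique
    ⟨h₁, h₂⟩ ⟨rfl, rfl⟩

theorem existsUnique_cell (sq : IsTwoPullback top left p f) {Φ : TwoCell X E} {Ψ : TwoCell X A}
    (h : Φ ▷₂ p = Ψ ▷₂ f) : ∃! Θ : TwoCell X P, Θ ▷₂ top = Φ ∧ Θ ▷₂ left = Ψ := by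
  obtain ⟨φ⟩ := Φ
  obtain ⟨ψ⟩ := Ψ
  obtain ⟨k, ⟨rfl, rfl⟩, -⟩ := sq.existsUnique_lift _ _ (congrArg src h)
  obtain ⟨l, ⟨rfl, rfl⟩, -⟩ := sq.existsUnique_lift _ _ (congrArg tgt h)
  obtain ⟨θ, ⟨rfl, rfl⟩, hθ⟩ := sq.existsUnique_lift₂ k l φ ψ (of_eq_of.1 h)
  refine ⟨of θ, ⟨rfl, rfl⟩, fun Θ ⟨h₁, h₂⟩ => ?_⟩
  obtain ⟨θ', rfl⟩ := Θ.exists_of_eq (sq.hom_ext (congrArg src h₁) (congrArg src h₂))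
    (sq.hom_ext (congrArg tgt h₁) (congrArg tgt h₂))
  rw [hθ θ' ⟨of_injective h₁, of_injective h₂⟩]

-- The universal property for 1-cells is the one for identity 2-cells.
theorem of_existsUnique_cell (w : top ≫ p = left ≫ f)
    (lift : ∀ ⦃X : K⦄ (Φ : TwoCell X E) (Ψ : TwoCell X A), Φ ▷₂ p = Ψ ▷₂ f →
      ∃! Θ : TwoCell X P, Θ ▷₂ top = Φ ∧ Θ ▷₂ left = Ψ) : IsTwoPullback top left p f := by
  have lift₁ : ∀ ⦃X : K⦄ (e : X ⟶ E) (a : X ⟶ A), e ≫ p = a ≫ f →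
      ∃! h : X ⟶ P, h ≫ top = e ∧ h ≫ left = a := by
    intro X e a h
    obtain ⟨Θ, ⟨h₁, h₂⟩, hΘ⟩ := lift (of (𝟙 e)) (of (𝟙 a)) (by
      rw [of_id_whiskerRight, of_id_whiskerRight, h])
    refine ⟨Θ.src, ⟨congrArg src h₁, congrArg src h₂⟩, ?_⟩
    rintro k ⟨rfl, rfl⟩
    exact congrArg src (hΘ (of (𝟙 k)) ⟨of_id_whiskerRight _ _, of_id_whiskerRight _ _⟩)
  refine ⟨w, lift₁, fun X h k σ τ e => ?_⟩
  obtain ⟨Θ, ⟨h₁, h₂⟩, hΘ⟩ := lift (of σ) (of τ) (of_eq_of.2 e)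
  have hom_ext (h k : X ⟶ P) (e₁ : h ≫ top = k ≫ top) (e₂ : h ≫ left = k ≫ left) : h = k :=
    (lift₁ (k ≫ top) (k ≫ left) (by rw [Strict.assoc, Strict.assoc, w])).unique
      ⟨e₁, e₂⟩ ⟨rfl, rfl⟩
  obtain ⟨θ, rfl⟩ := Θ.exists_of_eq (hom_ext _ h (congrArg src h₁) (congrArg src h₂))
    (hom_ext _ k (congrArg tgt h₁) (congrArg tgt h₂))
  exact ⟨θ, ⟨of_injective h₁, of_injective h₂⟩, fun θ' hθ' => of_injective
    (hΘ (of θ') ⟨congrArg of hθ'.1, congrArg of hθ'.2⟩)⟩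

theorem paste (sq : IsTwoPullback top left p f) {E' B' : K} {top' : E ⟶ E'} {p' : E' ⟶ B'}
    {f' : B ⟶ B'} (sq' : IsTwoPullback top' p p' f') :
    IsTwoPullback (top ≫ top') left p' (f ≫ f') := by
  refine of_existsUnique_cell ?_ fun X Φ Ψ h => ?_
  · rw [Strict.assoc, sq'.w, ← Strict.assoc, sq.w, Strict.assoc]
  rw [← whiskerRight_whiskerRight] at h
  obtain ⟨Φ₁, ⟨h₁, h₂⟩, hΦ₁⟩ := sq'.existsUnique_cell h
  obtain ⟨Θ, ⟨h₃, h₄⟩, hΘ⟩ := sq.existsUnique_cell h₂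
  refine ⟨Θ, ⟨by rw [← whiskerRight_whiskerRight, h₃, h₁], h₄⟩, fun Θ' ⟨h₅, h₆⟩ => hΘ Θ' ⟨?_, h₆⟩⟩
  exact hΦ₁ _ ⟨by rw [whiskerRight_whiskerRight, h₅],
    by rw [whiskerRight_whiskerRight, sq.w, ← whiskerRight_whiskerRight, h₆]⟩

theorem of_iso (sq : IsTwoPullback top left p f) {Q : K} {c : Q ⟶ P} {d : P ⟶ Q}
    (hcd : c ≫ d = 𝟙 Q) (hdc : d ≫ c = 𝟙 P) : IsTwoPullback (c ≫ top) (c ≫ left) p f := by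
  refine of_existsUnique_cell (by rw [Strict.assoc, Strict.assoc, sq.w]) fun X Φ Ψ h => ?_
  obtain ⟨Θ, ⟨rfl, rfl⟩, hΘ⟩ := sq.existsUnique_cell h
  refine ⟨Θ ▷₂ d, ?_, fun Θ' ⟨h₁, h₂⟩ => ?_⟩
  · simp only [whiskerRight_whiskerRight, ← Strict.assoc, hdc, Strict.id_comp, and_self]
  · have hc : Θ' ▷₂ c = Θ :=
      hΘ _ ⟨by rw [whiskerRight_whiskerRight, h₁], by rw [whiskerRight_whiskerRight, h₂]⟩
    rw [← hc, whiskerRight_whiskerRight, hcd, TwoCell.whiskerRight_id]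

theorem exists_iso (sq : IsTwoPullback top left p f) {Q : K} {top' : Q ⟶ E} {left' : Q ⟶ A}
    (sq' : IsTwoPullback top' left' p f) :
    ∃ (c : Q ⟶ P) (d : P ⟶ Q), c ≫ d = 𝟙 Q ∧ d ≫ c = 𝟙 P ∧ c ≫ top = top' ∧ c ≫ left = left' := by
  obtain ⟨c, ⟨rfl, rfl⟩, -⟩ := sq.existsUnique_lift top' left' sq'.w
  obtain ⟨d, ⟨h₁, h₂⟩, -⟩ := sq'.existsUnique_lift top left sq.w
  rw [← Strict.assoc] at h₁ h₂
  refine ⟨c, d, sq'.hom_ext ?_ ?_, sq.hom_ext ?_ ?_, rfl, rfl⟩ <;>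
    rw [Strict.id_comp]
  · rw [← Strict.assoc, Strict.assoc c, Strict.assoc c, h₁]
  · rw [← Strict.assoc, Strict.assoc c, Strict.assoc c, h₂]
  · exact h₁
  · exact h₂

theorem id_left (p : E ⟶ B) : IsTwoPullback (𝟙 E) p p (𝟙 B) := by
  refine of_existsUnique_cell (by rw [Strict.id_comp, Strict.comp_id]) fun X Φ Ψ h => ?_
  rw [TwoCell.whiskerRight_id] at h
  exact ⟨Φ, ⟨TwoCell.whiskerRight_id Φ, h⟩,
    fun Θ hΘ => by rw [← hΘ.1, TwoCell.whiskerRight_id]⟩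

theorem id_top (f : A ⟶ B) : IsTwoPullback f (𝟙 A) (𝟙 B) f := by
  refine of_existsUnique_cell (by rw [Strict.id_comp, Strict.comp_id]) fun X Φ Ψ h => ?_
  rw [TwoCell.whiskerRight_id] at h
  exact ⟨Ψ, ⟨h.symm, TwoCell.whiskerRight_id Ψ⟩,
    fun Θ hΘ => by rw [← hΘ.2, TwoCell.whiskerRight_id]⟩

theorem isDiscOpfib (sq : IsTwoPullback top left p f) (hp : IsDiscOpfib p) :
    IsDiscOpfib left := by
  intro X e b φ
  obtain ⟨_, Λ, hs, -, hΛ⟩ := hp.exists_transports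
    (show (e ≫ top) ≫ p = (of φ ▷₂ f).src by
      rw [whiskerRight_src, Strict.assoc, sq.w, Strict.assoc])
  obtain ⟨Θ, ⟨h₁, h₂⟩, hΘ⟩ := sq.existsUnique_cell hΛ
  obtain @⟨e₁, e', θ⟩ := Θ
  obtain rfl : e₁ = e := sq.hom_ext ((congrArg src h₁).trans hs) (congrArg src h₂)
  refine ⟨⟨e', θ⟩, of_eq_of.1 h₂, fun ⟨e'', ψ⟩ hψ => ?_⟩
  have h₃ : of ψ ▷₂ left = of φ := of_eq_of.2 hψ
  have h₄ : of ψ ▷₂ top = Λ := hp.cell_ext hs.symm (by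
    rw [whiskerRight_whiskerRight, sq.w, ← whiskerRight_whiskerRight, h₃, hΛ])
  obtain ⟨-, rfl, h⟩ := of_eq_of.1 (hΘ (of ψ) ⟨h₄, h₃⟩)
  rw [eq_of_heq h]

end IsTwoPullback

section Classifier

open TwoCell

variable {K : Type u} [Bicategory.{w, v} K]

theorem IsTwoPullback.reindex_eq_iff [Bicategory.Strict K] {P P' E A B : K} {top : P ⟶ E}
    {left : P ⟶ A} {top' : P' ⟶ E} {left' : P' ⟶ A} {p : E ⟶ B} {f f' : A ⟶ B}
    (hp : IsDiscOpfib p) (sq : IsTwoPullback top left p f) (sq' : IsTwoPullback top' left' p f')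
    (φ : f ⟶ f') {h : P ⟶ P'} (hh : h ≫ left' = left) :
    reindex hp sq sq' φ = ⟨h, hh⟩ ↔ (left ◁₂ of φ).Transports p top (h ≫ top') := by
  rw [show left ◁₂ of φ = of (eqToHom sq.w ≫ left ◁ φ) from (of_eqToHom_comp _ _).symm,
    ← hp.push_eq_iff, Subtype.ext_iff]
  constructor
  · intro e
    exact (sq'.lift_top _ _ (hp.push_comp _ _)).symm.trans (congrArg (· ≫ top') e)
  · intro e
    exact sq'.hom_ext ((sq'.lift_top _ _ (hp.push_comp _ _)).trans e)
      ((sq'.lift_left _ _ (hp.push_comp _ _)).trans hh.symm)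

/-- `s : Z ⟶ P` is generating if some map factoring through `s` has a 2-cell to the identity of
`P`. Among pointed sets and all functions between them, regarded as elements of the classifier, the
singleton is generating: each pointed set is the target of a unique map from it. -/
def IsGenerating {Z P : K} (s : Z ⟶ P) : Prop :=
  ∃ r : P ⟶ Z, Nonempty (r ≫ s ⟶ 𝟙 P)

theorem IsGenerating.map [Bicategory.Strict K] [Enhancement K] (M : EnhancedMonad K) {Z P : K}
    {s : Z ⟶ P} (hs : IsGenerating s) : IsGenerating (M.T.map s) := by
  obtain ⟨r, ⟨ξ⟩⟩ := hs
  exact ⟨M.T.map r,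
    ⟨eqToHom (M.T.map_comp r s).symm ≫ M.T.map₂ ξ ≫ eqToHom (M.T.map_id P)⟩⟩

namespace IsTwoClassifier

variable [Enhancement K] {S : SmallClass K} {Ω' Ω : K} {u : Ω' ⟶ Ω}

theorem discOpfib (hu : IsTwoClassifier S u) : IsDiscOpfib u :=
  (S.tightDiscOpfib hu.small).discOpfib

theorem detects_tight (hu : IsTwoClassifier S u) {E B X : K} {p : E ⟶ B} (hp : S.Small p)
    {h : X ⟶ E} (hh : IsTight (h ≫ p)) : IsTight h := by
  obtain ⟨f, top, sq⟩ := hu.exists_classifies p hp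
  exact sq.detects_tight h hh

variable [Bicategory.Strict K] {P B : K} {top : P ⟶ Ω'} {left : P ⟶ B} {f : B ⟶ Ω}

theorem existsUnique_cell (hK : IsPlumbus K) (hu : IsTwoClassifier S u)
    (sq : IsTwoPullback top left u f) {f' : B ⟶ Ω} {e' : P ⟶ Ω'} (he' : e' ≫ u = left ≫ f') :
    ∃! φ : f ⟶ f', (left ◁₂ of φ).Transports u top e' := by
  obtain ⟨P₀, top₀, left₀, sq₀⟩ := hK.exists_pullback u f (S.tightDiscOpfib hu.small)
  obtain ⟨P₁, top₁, left₁, sq₁⟩ := hK.exists_pullback u f' (S.tightDiscOpfib hu.small)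
  obtain ⟨c, d, hcd, hdc, rfl, rfl⟩ := sq₀.exists_iso sq
  obtain ⟨k, ⟨hk, hk'⟩, -⟩ := sq₁.existsUnique_lift (d ≫ e') left₀ (by
    rw [Strict.assoc, he', ← Strict.assoc, ← Strict.assoc, hdc, Strict.id_comp])
  have reindex_iff (φ : f ⟶ f') :
      sq₀.reindex hu.discOpfib sq₁.toIsTwoPullback φ = ⟨k, hk'⟩ ↔
        ((c ≫ left₀) ◁₂ of φ).Transports u (c ≫ top₀) e' := by
    rw [IsTwoPullback.reindex_eq_iff, hk]
    refine ⟨fun h => ?_, fun h => ?_⟩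
    · have := h.whiskerLeft c
      rwa [whiskerLeft_whiskerLeft, ← Strict.assoc, hcd, Strict.id_comp] at this
    · have := h.whiskerLeft d
      rwa [whiskerLeft_whiskerLeft, ← Strict.assoc, ← Strict.assoc, hdc, Strict.id_comp,
        Strict.id_comp] at this
  simpa only [reindex_iff] using (hu.fullyFaithful sq₀ sq₁).existsUnique ⟨k, hk'⟩

theorem cell_ext (hK : IsPlumbus K) (hu : IsTwoClassifier S u) (sq : IsTwoPullback top left u f)
    {Φ Ψ : TwoCell B Ω} {e' : P ⟶ Ω'} (hΦ : Φ.src = f) (hΨ : Ψ.src = f) (ht : Φ.tgt = Ψ.tgt)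
    (h₁ : (left ◁₂ Φ).Transports u top e') (h₂ : (left ◁₂ Ψ).Transports u top e') : Φ = Ψ := by
  obtain @⟨f₁, g, φ⟩ := Φ
  obtain @⟨f₂, g', ψ⟩ := Ψ
  obtain rfl : f₁ = f := hΦ
  obtain rfl : f₂ = f₁ := hΨ
  obtain rfl : g = g' := ht
  rw [(hu.existsUnique_cell hK sq h₁.tgt_eq).unique h₁ h₂]

-- A section of a pullback of `u` over its identity leg has to be the canonical one.
theorem cell_eq_id (hK : IsPlumbus K) (hu : IsTwoClassifier S u) {t : B ⟶ Ω'}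
    (sq : IsTwoPullback t (𝟙 B) u f) {Φ : TwoCell B Ω} (hs : Φ.src = f) (ht : Φ.tgt = f) :
    Φ = of (𝟙 f) := by
  obtain ⟨t', h⟩ := hu.discOpfib.exists_transports (e := t) (by rw [sq.w, hs, Strict.id_comp])
  obtain ⟨k, ⟨hk, hk'⟩, -⟩ := sq.existsUnique_lift t' (𝟙 B) (by
    rw [h.tgt_eq, ht, Strict.id_comp])
  obtain rfl : t = t' := by
    rw [← hk, ← Strict.comp_id k, hk', Strict.id_comp]
  refine hu.cell_ext hK sq hs rfl ht (e' := t) ?_ ?_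
  · rwa [TwoCell.id_whiskerLeft]
  · have := transports_id t u
    rwa [sq.w, ← whiskerLeft_of_id] at this

/- The two lifts of `left ≫ f` differ by a 2-cell `φ : f ⟶ f`, which is trivial on `Z`; by
interchange with `r ≫ s ⟶ 𝟙 P`, transport along `left ◁ φ` is trivial on all of `P`. -/
theorem top_unique (hK : IsPlumbus K) (hu : IsTwoClassifier S u)
    (sq : IsTwoPullback top left u f) {Z : K} {s : Z ⟶ P} (hs : IsGenerating s)
    (sqZ : IsTwoPullback (s ≫ top) (𝟙 Z) u (s ≫ left ≫ f)) {top' : P ⟶ Ω'}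
    (h : top' ≫ u = left ≫ f) : top' = top := by
  obtain ⟨φ, hφ, -⟩ := hu.existsUnique_cell hK sq h
  obtain ⟨r, ⟨ξ⟩⟩ := hs
  have hZ : (s ≫ left) ◁₂ of φ = of (𝟙 (s ≫ left ≫ f)) :=
    hu.cell_eq_id hK sqZ (Strict.assoc _ _ _) (Strict.assoc _ _ _)
  obtain ⟨Ξ, h₁, h₂⟩ := interchange (of ξ) (left ◁₂ of φ)
  have hΞ : Ξ = of ξ ▷₂ (left ≫ f) := by
    rw [whiskerLeft_whiskerLeft, Strict.assoc, ← whiskerLeft_whiskerLeft, hZ,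
      whiskerLeft_of_id] at h₁
    exact h₁.eq_right
  have hξ : (of ξ ▷₂ (left ≫ f)).Transports u ((r ≫ s) ≫ top) top := by
    have := transports_whiskerRight (of ξ ▷₂ top) u
    rwa [whiskerRight_whiskerRight, sq.w, whiskerRight_src, whiskerRight_tgt,
      Strict.id_comp] at this
  rw [TwoCell.id_whiskerLeft, hΞ] at h₂
  exact hu.discOpfib.transports_unique (hξ.comp hφ h₂) hξ

theorem exists_isGenerating (hK : IsPlumbus K) (hu : IsTwoClassifier S u) :
    ∃ (Z : K) (t : Z ⟶ Ω'), IsGenerating t ∧ IsTwoPullback t (𝟙 Z) u (t ≫ u) := by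
  obtain ⟨Z, hZ⟩ := hK.exists_terminal
  obtain ⟨z, t, sq⟩ := hu.exists_classifies _ (S.id_terminal hZ)
  obtain ⟨⟨⟨r⟩, -⟩⟩ := hZ.unique_hom Ω'
  obtain ⟨φ, ⟨Λ, hs, ht, -⟩, -⟩ := hu.existsUnique_cell hK
    ((IsTwoPullback.id_top r).paste sq.toIsTwoPullback) (f' := u) (e' := 𝟙 Ω') rfl
  obtain ⟨ξ, -⟩ := Λ.exists_of_eq hs ht
  refine ⟨Z, t, ⟨r, ⟨ξ⟩⟩, ?_⟩
  rw [sq.w, Strict.id_comp]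
  exact sq.toIsTwoPullback

end IsTwoClassifier

end Classifier

namespace EnhancedMonad

open TwoCell

variable {K : Type u} [Bicategory.{w, v} K] [Bicategory.Strict K] [Enhancement K]

section AlgebraOnTop

variable {Ω' Ω : K} {u : Ω' ⟶ Ω}

/-- `T` sends every left-tight pullback of `u` to a 2-pullback. -/
def PreservesPullbacksOf (M : EnhancedMonad K) {Ω' Ω : K} (u : Ω' ⟶ Ω) : Prop :=
  ∀ ⦃P B : K⦄ ⦃top : P ⟶ Ω'⦄ ⦃left : P ⟶ B⦄ ⦃f : B ⟶ Ω⦄, IsLeftTightPullback top left u f →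
    IsTwoPullback (M.T.map top) (M.T.map left) (M.T.map u) (M.T.map f)

variable {M : EnhancedMonad K}

theorem PreservesPullbacksOf.map (hT : M.PreservesPullbacksOf u) (hK : IsPlumbus K)
    (hu : IsTightDiscOpfib u) {P B : K} {top : P ⟶ Ω'} {left : P ⟶ B} {f : B ⟶ Ω}
    (sq : IsTwoPullback top left u f) :
    IsTwoPullback (M.T.map top) (M.T.map left) (M.T.map u) (M.T.map f) := by
  obtain ⟨_, _, _, sq₀⟩ := hK.exists_pullback u f hu
  obtain ⟨c, d, hcd, hdc, rfl, rfl⟩ := sq₀.toIsTwoPullback.exists_iso sq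
  rw [M.T.map_comp, M.T.map_comp]
  exact (hT sq₀).of_iso (d := M.T.map d) (by rw [← M.T.map_comp, hcd, M.T.map_id])
    (by rw [← M.T.map_comp, hdc, M.T.map_id])

variable {S : SmallClass K} {ω' : M.T.obj Ω' ⟶ Ω'} {ω : M.T.obj Ω ⟶ Ω}

theorem PreservesPullbacksOf.isAlgebra_top (hT : M.PreservesPullbacksOf u) (hK : IsPlumbus K)
    (hu : IsTwoClassifier S u) (sqω : IsTwoPullback ω' (M.T.map u) u ω) (hω : M.IsAlgebra ω) :
    M.IsAlgebra ω' := by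
  have hu' := S.tightDiscOpfib hu.small
  have map_paste {P B : K} {top : P ⟶ Ω'} {left : P ⟶ B} {f : B ⟶ Ω}
      (sq : IsTwoPullback top left u f) :
      IsTwoPullback (M.T.map top ≫ ω') (M.T.map left) u (M.T.map f ≫ ω) :=
    (hT.map hK hu' sq).paste sqω
  obtain ⟨Z, t, ht, sqZ⟩ := hu.exists_isGenerating hK
  refine ⟨hu.detects_tight hu.small ?_, ?_, ?_⟩
  · rw [sqω.w]
    exact comp_tight _ _ (M.map_tight _ hu'.tight) hω.tight
  · refine hu.top_unique hK (IsTwoPullback.id_left u) ht ?_ ?_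
    · rwa [Strict.comp_id, Strict.comp_id]
    · rw [Strict.assoc, sqω.w, ← Strict.assoc, ← M.unit_natural, Strict.assoc, hω.unit]
  · refine (hu.top_unique hK (map_paste sqω) ((ht.map M).map M) ?_ ?_).symm
    · have := map_paste (map_paste sqZ)
      simpa only [M.T.map_id, M.T.map_comp, Strict.assoc] using this
    · rw [Strict.assoc, sqω.w, ← Strict.assoc, ← M.mult_natural, Strict.assoc, hω.mult]

end AlgebraOnTop

variable {M : EnhancedMonad K}

namespace LaxHom

variable {A B C : M.Alg}

theorem of_lax_unit (f : LaxHom A B) : M.unit A.carrier ◁₂ of f.lax = of (𝟙 f.hom) :=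
  of_eq_of.2 f.lax_unit

theorem isComp_lax_mult (f : LaxHom A B) : IsComp ((of f.lax).map M ▷₂ B.str)
    (M.T.map A.str ◁₂ of f.lax) (M.mult A.carrier ◁₂ of f.lax) :=
  isComp_of_iff.2 ⟨_, of_eq_of.2 f.lax_mult⟩

theorem exists_of_isComp {f : A.carrier ⟶ B.carrier} {Φ : TwoCell (M.T.obj A.carrier) B.carrier}
    (hs : Φ.src = M.T.map f ≫ B.str) (ht : Φ.tgt = A.str ≫ f)
    (hunit : M.unit A.carrier ◁₂ Φ = of (𝟙 f))
    (hmult : IsComp (Φ.map M ▷₂ B.str) (M.T.map A.str ◁₂ Φ) (M.mult A.carrier ◁₂ Φ)) :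
    ∃ F : LaxHom A B, F.hom = f ∧ of F.lax = Φ := by
  obtain ⟨φ, rfl⟩ := Φ.exists_of_eq hs ht
  obtain ⟨_, h⟩ := isComp_of_iff.1 hmult
  exact ⟨⟨f, φ, of_eq_of.1 hunit, of_eq_of.1 h⟩, rfl, rfl⟩

theorem isComp_comp_lax (f : LaxHom A B) (g : LaxHom B C) :
    IsComp (M.T.map f.hom ◁₂ of g.lax) (of f.lax ▷₂ g.hom) (of (f.comp g).lax) :=
  isComp_of_iff.2 ⟨_, of_eq_of.2 (comp_lax f g)⟩

theorem isStrict_ofStrict (f : A.carrier ⟶ B.carrier) (h : M.T.map f ≫ B.str = A.str ≫ f) :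
    (ofStrict f h).IsStrict :=
  CellEq.eqToHom_left h

theorem IsStrict.of_lax {f : LaxHom A B} (hf : f.IsStrict) :
    of f.lax = of (𝟙 (M.T.map f.hom ≫ B.str)) :=
  of_eq_of.2 hf

theorem IsStrict.of_comp_lax {g : LaxHom B C} (hg : g.IsStrict) (f : LaxHom A B) :
    of (f.comp g).lax = of f.lax ▷₂ g.hom := by
  have h := isComp_comp_lax f g
  rw [hg.of_lax, whiskerLeft_of_id] at h
  exact h.eq_right

theorem IsStrict.of_lax_comp {f : LaxHom A B} (hf : f.IsStrict) (g : LaxHom B C) :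
    of (f.comp g).lax = M.T.map f.hom ◁₂ of g.lax := by
  have h := isComp_comp_lax f g
  rw [hf.of_lax, of_id_whiskerRight] at h
  exact h.eq_left

theorem IsStrict.transports_comp_lax {p : LaxHom B C} (hp : p.IsStrict) (f : LaxHom A B) :
    (of (f.comp p).lax).Transports p.hom (M.T.map f.hom ≫ B.str) (A.str ≫ f.hom) :=
  ⟨of f.lax, rfl, rfl, (hp.of_comp_lax f).symm⟩

theorem ext_of_lax {f g : LaxHom A B} (h : f.hom = g.hom) (hl : of f.lax = of g.lax) : f = g :=
  ext_cellEq h (of_eq_of.1 hl)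

theorem IsStrict.exists_lift {p : LaxHom B C} (hp : p.IsStrict) (hp' : IsDiscOpfib p.hom)
    (a : LaxHom A C) {k : A.carrier ⟶ B.carrier} (hk : k ≫ p.hom = a.hom)
    (h : (of a.lax).Transports p.hom (M.T.map k ≫ B.str) (A.str ≫ k)) :
    ∃ f : LaxHom A B, f.hom = k ∧ f.comp p = a := by
  obtain ⟨Λ, hs, ht, hΛ⟩ := h
  have hunit : M.unit A.carrier ◁₂ Λ = of (𝟙 k) := by
    refine hp'.cell_ext ?_ ?_
    · rw [whiskerLeft_src, hs, ← Strict.assoc, ← M.unit_natural, Strict.assoc, B.isAlgebra.unit,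
        Strict.comp_id]
    · rw [whiskerLeft_whiskerRight, hΛ, a.of_lax_unit, of_id_whiskerRight, hk]
  have hmult : IsComp (Λ.map M ▷₂ B.str) (M.T.map A.str ◁₂ Λ) (M.mult A.carrier ◁₂ Λ) := by
    refine hp'.isComp_of_whiskerRight ?_ ?_ ?_
    · rw [whiskerLeft_src, whiskerRight_src, map_src, hs, M.T.map_comp, Strict.assoc,
        B.isAlgebra.mult, ← Strict.assoc, ← Strict.assoc, M.mult_natural]
    · rw [whiskerLeft_src, whiskerRight_tgt, map_tgt, hs, ht, M.T.map_comp, Strict.assoc]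
    · rw [whiskerLeft_whiskerRight, whiskerLeft_whiskerRight, hΛ, whiskerRight_whiskerRight,
        ← hp.comm, ← whiskerRight_whiskerRight, ← map_whiskerRight, hΛ]
      exact a.isComp_lax_mult
  obtain ⟨f, rfl, hf⟩ := exists_of_isComp hs ht hunit hmult
  exact ⟨f, rfl, ext_of_lax hk ((hp.of_comp_lax f).trans (hf ▸ hΛ))⟩

end LaxHom

namespace LaxCell

variable {A B : M.Alg}

theorem cell_congr {f g f' g' : A ⟶ B} {σ : f ⟶ g} {τ : f' ⟶ g'} (h : σ ≗ τ) :
    LaxCell.cell σ ≗ LaxCell.cell τ := by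
  obtain ⟨rfl, rfl, h⟩ := h
  rw [eq_of_heq h]
  exact CellEq.refl _

theorem exists_isComp {f g : LaxHom A B} (σ : LaxCell f g) :
    ∃ Z, IsComp (of f.lax) (A.str ◁₂ of σ.cell) Z ∧
      IsComp ((of σ.cell).map M ▷₂ B.str) (of g.lax) Z :=
  ⟨_, .mk f.lax (A.str ◁ σ.cell), σ.comm ▸ .mk (M.T.map₂ σ.cell ▷ B.str) g.lax⟩

end LaxCell

namespace LaxHom

variable {A B C : M.Alg} {p : LaxHom B C}

theorem IsStrict.hom_ext (hp : p.IsStrict) (hp' : IsDiscOpfib p.hom) {f g : LaxHom A B}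
    (h : f.hom = g.hom) (hfg : f.comp p = g.comp p) : f = g := by
  refine ext_of_lax h (hp'.cell_ext (congrArg (fun k => M.T.map k ≫ B.str) h) ?_)
  rw [← hp.of_comp_lax, ← hp.of_comp_lax, hfg]

theorem IsStrict.of_comp (hp : p.IsStrict) (hp' : IsDiscOpfib p.hom) {f : LaxHom A B}
    (h : (f.comp p).IsStrict) : f.IsStrict := by
  refine of_eq_of.1 (hp'.cell_ext rfl ?_)
  rw [← hp.of_comp_lax, h.of_lax, of_id_whiskerRight, Strict.assoc, ← hp.comm, ← Strict.assoc,
    ← M.T.map_comp]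
  rfl

theorem IsStrict.exists_cell_lift (hp : p.IsStrict) (hp' : IsDiscOpfib p.hom) {f g : LaxHom A B}
    {θ : f.hom ⟶ g.hom} {τ : LaxCell (f.comp p) (g.comp p)} (h : τ.cell = θ ▷ p.hom) :
    ∃ σ : LaxCell f g, σ.cell = θ := by
  refine ⟨⟨θ, of_injective (hp'.cell_ext rfl ?_)⟩, rfl⟩
  obtain ⟨Z, h₁, h₂⟩ := τ.exists_isComp
  have e : of τ.cell = of θ ▷₂ p.hom := congrArg of h
  rw [hp.of_comp_lax, e, ← whiskerLeft_whiskerRight] at h₁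
  rw [hp.of_comp_lax, e, map_whiskerRight, whiskerRight_whiskerRight, hp.comm,
    ← whiskerRight_whiskerRight] at h₂
  exact (((IsComp.mk f.lax (A.str ◁ θ)).whiskerRight p.hom).unique h₁).trans
    (((IsComp.mk (M.T.map₂ θ ▷ B.str) g.lax).whiskerRight p.hom).unique h₂).symm

end LaxHom

section Pullback

variable {E B U' U : M.Alg} {t : E ⟶ U'} {p : E ⟶ B} {q : U' ⟶ U} {f : B ⟶ U}

theorem transports_lax (hps : p.IsStrict) (hqs : q.IsStrict) (hw : t ≫ q = p ≫ f) :
    (M.T.map p.hom ◁₂ of f.lax).Transports q.hom (M.T.map t.hom ≫ U'.str) (E.str ≫ t.hom) := by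
  have h := hqs.transports_comp_lax t
  rwa [show t.comp q = p.comp f from hw, hps.of_lax_comp] at h

theorem exists_lift_of_underlying (hps : p.IsStrict) (hp : IsDiscOpfib p.hom) (hqs : q.IsStrict)
    (hq : IsDiscOpfib q.hom) (hw : t ≫ q = p ≫ f) (sq : IsTwoPullback t.hom p.hom q.hom f.hom)
    {X : M.Alg} (e : X ⟶ U') (a : X ⟶ B) (hea : e ≫ q = a ≫ f) :
    ∃ k : X ⟶ E, k ≫ t = e ∧ k ≫ p = a := by
  obtain ⟨k, ⟨hke, hka⟩, -⟩ := sq.existsUnique_lift e.hom a.hom (congrArg LaxHom.hom hea)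
  obtain ⟨m, hm⟩ := hp.exists_transports (e := M.T.map k ≫ E.str) (Φ := of a.lax) (by
    rw [Strict.assoc, ← hps.comm, ← Strict.assoc, ← M.T.map_comp, hka])
  have ht : (M.T.map a.hom ◁₂ of f.lax).Transports q.hom (M.T.map e.hom ≫ U'.str)
      ((M.T.map k ≫ E.str) ≫ t.hom) := by
    have := (transports_lax hps hqs hw).whiskerLeft (M.T.map k)
    rwa [whiskerLeft_whiskerLeft, ← M.T.map_comp, hka, ← Strict.assoc, ← M.T.map_comp, hke,
      ← Strict.assoc] at this
  have he := hqs.transports_comp_lax e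
  rw [show e.comp q = a.comp f from hea] at he
  obtain rfl : m = X.str ≫ k := sq.hom_ext
    ((hq.transports_unique (ht.comp (hm.whiskerRight sq.w) (a.isComp_comp_lax f)) he).trans
      (by rw [Strict.assoc, hke]))
    (hm.tgt_eq.trans (by rw [Strict.assoc, hka]))
  obtain ⟨k, rfl, rfl⟩ := hps.exists_lift hp a hka hm
  refine ⟨k, hqs.hom_ext hq hke ?_, rfl⟩
  exact (Strict.assoc k t q).trans ((congrArg (k ≫ ·) hw).trans
    ((Strict.assoc k p f).symm.trans hea.symm))

theorem isTwoPullback_of_underlying (hps : p.IsStrict) (hp : IsDiscOpfib p.hom)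
    (hqs : q.IsStrict) (hq : IsDiscOpfib q.hom) (hw : t ≫ q = p ≫ f)
    (sq : IsTwoPullback t.hom p.hom q.hom f.hom) : IsTwoPullback t p q f := by
  refine ⟨hw, fun X e a hea => ?_, fun X h k σ τ hστ => ?_⟩
  · obtain ⟨k, rfl, rfl⟩ := exists_lift_of_underlying hps hp hqs hq hw sq e a hea
    exact ⟨k, ⟨rfl, rfl⟩, fun k' ⟨h₁, h₂⟩ => hps.hom_ext hp
      (sq.hom_ext (congrArg LaxHom.hom h₁) (congrArg LaxHom.hom h₂)) h₂⟩
  · obtain ⟨θ, ⟨h₁, h₂⟩, hθ⟩ := sq.existsUnique_lift₂ h.hom k.hom (LaxCell.cell σ)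
      (LaxCell.cell τ) (LaxCell.cell_congr hστ)
    obtain ⟨θ, rfl⟩ := hps.exists_cell_lift hp h₂.symm
    exact ⟨θ, ⟨LaxCell.hom_ext h₁, LaxCell.hom_ext h₂⟩, fun θ' ⟨h₃, h₄⟩ => LaxCell.hom_ext
      (hθ _ ⟨congrArg LaxCell.cell h₃, congrArg LaxCell.cell h₄⟩)⟩

theorem isLeftTightPullback_of_underlying (hpt : IsTight p) (hp : IsDiscOpfib p.hom)
    (hd : ∀ ⦃X : K⦄ (h : X ⟶ E.carrier), IsTight (h ≫ p.hom) → IsTight h) (hqs : q.IsStrict)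
    (hq : IsDiscOpfib q.hom) (hw : t ≫ q = p ≫ f) (sq : IsTwoPullback t.hom p.hom q.hom f.hom) :
    IsLeftTightPullback t p q f where
  toIsTwoPullback := isTwoPullback_of_underlying hpt.1 hp hqs hq hw sq
  left_tight := hpt
  detects_tight _ h hh := ⟨hpt.1.of_comp hp hh.1, hd h.hom hh.2⟩

end Pullback

section TransportLaws

variable {C D P B : K} {γ : M.T.obj C ⟶ C} {χ : M.T.obj D ⟶ D} {q : C ⟶ D} {p : P ⟶ B}
  {π : M.T.obj P ⟶ P} {β : M.T.obj B ⟶ B} {e : P ⟶ C} {Φ : TwoCell (M.T.obj B) D}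
  {Ψ : TwoCell (M.T.obj (M.T.obj B)) D}

theorem IsAlgebra.transports_unit (hγ : M.IsAlgebra γ)
    (h : (M.T.map p ◁₂ Φ).Transports q (M.T.map e ≫ γ) (π ≫ e)) :
    (p ◁₂ M.unit B ◁₂ Φ).Transports q e (M.unit P ≫ π ≫ e) := by
  have := h.whiskerLeft (M.unit P)
  rwa [whiskerLeft_whiskerLeft, ← M.unit_natural, ← whiskerLeft_whiskerLeft, ← Strict.assoc,
    ← M.unit_natural, Strict.assoc, hγ.unit, Strict.comp_id] at this

theorem IsAlgebra.transports_mult (hγ : M.IsAlgebra γ)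
    (h : (M.T.map p ◁₂ Φ).Transports q (M.T.map e ≫ γ) (π ≫ e)) :
    (M.T.map (M.T.map p) ◁₂ M.mult B ◁₂ Φ).Transports q (M.T.map (M.T.map e ≫ γ) ≫ γ)
      (M.mult P ≫ π ≫ e) := by
  have := h.whiskerLeft (M.mult P)
  rwa [whiskerLeft_whiskerLeft, ← M.mult_natural, ← whiskerLeft_whiskerLeft, ← Strict.assoc,
    ← M.mult_natural, Strict.assoc, ← hγ.mult, ← Strict.assoc, ← M.T.map_comp] at this

theorem transports_map_comp (hq : M.T.map q ≫ χ = γ ≫ q) (hπ : π ≫ p = M.T.map p ≫ β)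
    (h : (M.T.map p ◁₂ Φ).Transports q (M.T.map e ≫ γ) (π ≫ e))
    (hΨ : IsComp (Φ.map M ▷₂ χ) (M.T.map β ◁₂ Φ) Ψ) :
    (M.T.map (M.T.map p) ◁₂ Ψ).Transports q (M.T.map (M.T.map e ≫ γ) ≫ γ)
      (M.T.map π ≫ π ≫ e) := by
  have h₁ := (h.map M).whiskerRight hq.symm
  have h₂ := h.whiskerLeft (M.T.map π)
  rw [map_whiskerLeft, whiskerLeft_whiskerRight, M.T.map_comp π, Strict.assoc] at h₁
  rw [whiskerLeft_whiskerLeft, ← M.T.map_comp, hπ, M.T.map_comp,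
    ← whiskerLeft_whiskerLeft] at h₂
  exact h₁.comp h₂ (hΨ.whiskerLeft _)

end TransportLaws

section Pullback

variable {B U' U : M.Alg} {q : U' ⟶ U}

theorem isAlgebra_of_transports (hqs : q.IsStrict) (hq : IsDiscOpfib q.hom) {f : B ⟶ U} {P : K}
    {top : P ⟶ U'.carrier} {left : P ⟶ B.carrier} {π : M.T.obj P ⟶ P}
    (sq : IsLeftTightPullback top left q.hom f.hom) (hπ : π ≫ left = M.T.map left ≫ B.str)
    (h : (M.T.map left ◁₂ of f.lax).Transports q.hom (M.T.map top ≫ U'.str) (π ≫ top)) :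
    M.IsAlgebra π where
  tight := by
    refine sq.detects_tight π ?_
    rw [hπ]
    exact comp_tight _ _ (M.map_tight _ sq.left_tight) B.isAlgebra.tight
  unit := by
    have h_unit := U'.isAlgebra.transports_unit h
    rw [f.of_lax_unit, whiskerLeft_of_id, ← sq.w] at h_unit
    refine sq.hom_ext ?_ ?_
    · rw [Strict.assoc, Strict.id_comp]
      exact hq.transports_unique h_unit (transports_id top q.hom)
    · rw [Strict.assoc, hπ, ← Strict.assoc, ← M.unit_natural, Strict.assoc, B.isAlgebra.unit,
        Strict.comp_id, Strict.id_comp]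
  mult := by
    refine sq.hom_ext ?_ ?_
    · rw [Strict.assoc, Strict.assoc]
      exact hq.transports_unique (transports_map_comp hqs.comm hπ h f.isComp_lax_mult)
        (U'.isAlgebra.transports_mult h)
    · rw [Strict.assoc, Strict.assoc, hπ, ← Strict.assoc, ← Strict.assoc, ← M.T.map_comp, hπ,
        ← M.mult_natural, M.T.map_comp, Strict.assoc, Strict.assoc, B.isAlgebra.mult]

theorem exists_isTwoPullback_of_transports {E : M.Alg} {p : E ⟶ B} {f : B ⟶ U}
    {top : E.carrier ⟶ U'.carrier} (hps : p.IsStrict) (hp : IsDiscOpfib p.hom) (hqs : q.IsStrict)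
    (hq : IsDiscOpfib q.hom) (sq : IsTwoPullback top p.hom q.hom f.hom)
    (h : (M.T.map p.hom ◁₂ of f.lax).Transports q.hom (M.T.map top ≫ U'.str) (E.str ≫ top)) :
    ∃ t : E ⟶ U', t.hom = top ∧ IsTwoPullback t p q f := by
  obtain ⟨t, rfl, ht⟩ := hqs.exists_lift hq (p.comp f) sq.w (hps.of_lax_comp f ▸ h)
  exact ⟨t, rfl, isTwoPullback_of_underlying hps hp hqs hq ht sq⟩

theorem exists_isTwoPullback_hom (hK : IsPlumbus K) (hqs : q.IsStrict)
    (hq : IsTightDiscOpfib q.hom) (f : B ⟶ U) :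
    ∃ (E : M.Alg) (t : E ⟶ U') (p : E ⟶ B),
      IsTwoPullback t.hom p.hom q.hom f.hom ∧ IsTwoPullback t p q f := by
  obtain ⟨P, top, left, sq⟩ := hK.exists_pullback q.hom f.hom hq
  obtain ⟨e, he⟩ := hq.discOpfib.exists_transports (e := M.T.map top ≫ U'.str)
    (Φ := M.T.map left ◁₂ of f.lax) (by
      rw [Strict.assoc, ← hqs.comm, ← Strict.assoc, ← M.T.map_comp, sq.w, M.T.map_comp,
        Strict.assoc, whiskerLeft_src])
  obtain ⟨π, ⟨rfl, hπ⟩, -⟩ := sq.existsUnique_lift e (M.T.map left ≫ B.str)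
    (he.tgt_eq.trans (Strict.assoc _ _ _).symm)
  let E : M.Alg := ⟨P, π, isAlgebra_of_transports hqs hq.discOpfib sq hπ he⟩
  let p : E ⟶ B := LaxHom.ofStrict (A := E) left hπ.symm
  obtain ⟨t, ht, sq'⟩ := exists_isTwoPullback_of_transports (p := p)
    (LaxHom.isStrict_ofStrict (A := E) left hπ.symm) (sq.isDiscOpfib hq.discOpfib) hqs hq.discOpfib
    sq.toIsTwoPullback he
  exact ⟨E, t, p, ht.symm ▸ sq.toIsTwoPullback, sq'⟩

theorem isTwoPullback_hom (hK : IsPlumbus K) (hqs : q.IsStrict) (hq : IsTightDiscOpfib q.hom)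
    {E : M.Alg} {t : E ⟶ U'} {p : E ⟶ B} {f : B ⟶ U} (sq : IsTwoPullback t p q f) :
    IsTwoPullback t.hom p.hom q.hom f.hom := by
  obtain ⟨E₀, t₀, p₀, sq₀, sq₁⟩ := exists_isTwoPullback_hom hK hqs hq f
  obtain ⟨c, d, hcd, hdc, rfl, rfl⟩ := sq₁.exists_iso sq
  exact sq₀.of_iso (congrArg LaxHom.hom hcd) (congrArg LaxHom.hom hdc)

end Pullback

section Classification

variable {S : SmallClass K} {E B U' U : M.Alg} {q : U' ⟶ U} {p : E ⟶ B}

theorem exists_transports_lax (hK : IsPlumbus K) (hu : IsTwoClassifier S q.hom)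
    (hqs : q.IsStrict) (sqU : IsTwoPullback U'.str (M.T.map q.hom) q.hom U.str)
    (hT : M.PreservesPullbacksOf q.hom) (hps : p.IsStrict) {g : B.carrier ⟶ U.carrier}
    {top : E.carrier ⟶ U'.carrier} (sq : IsTwoPullback top p.hom q.hom g) :
    ∃ f : B ⟶ U, f.hom = g ∧
      (M.T.map p.hom ◁₂ of f.lax).Transports q.hom (M.T.map top ≫ U'.str) (E.str ≫ top) := by
  have hu' := S.tightDiscOpfib hu.small
  have sqT := (hT.map hK hu' sq).paste sqU
  obtain ⟨φ, hφ, -⟩ := hu.existsUnique_cell hK sqT (f' := B.str ≫ g) (e' := E.str ≫ top) (by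
    rw [Strict.assoc, sq.w, ← Strict.assoc, ← hps.comm, Strict.assoc])
  have hunit : M.unit B.carrier ◁₂ of φ = of (𝟙 g) := by
    refine hu.cell_ext hK sq (e' := top) ?_ rfl ?_ ?_ ?_
    · rw [whiskerLeft_src, ← Strict.assoc, ← M.unit_natural, Strict.assoc, U.isAlgebra.unit,
        Strict.comp_id]
    · rw [whiskerLeft_tgt, ← Strict.assoc, B.isAlgebra.unit, Strict.id_comp]
    · have := U'.isAlgebra.transports_unit hφ
      rwa [← Strict.assoc, E.isAlgebra.unit, Strict.id_comp] at this
    · rw [whiskerLeft_of_id, ← sq.w]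
      exact transports_id top q.hom
  obtain ⟨Ψ, hΨ⟩ := exists_isComp (X := (of φ).map M ▷₂ U.str) (Y := M.T.map B.str ◁₂ of φ)
    (by rw [whiskerRight_tgt, map_tgt, whiskerLeft_src, M.T.map_comp, Strict.assoc])
  have hmult : M.mult B.carrier ◁₂ of φ = Ψ := by
    refine hu.cell_ext hK ((hT.map hK hu' sqT).paste sqU) ?_ hΨ.src_eq ?_
      (U'.isAlgebra.transports_mult hφ) ?_
    · rw [whiskerLeft_src, ← Strict.assoc, ← M.mult_natural, Strict.assoc, ← U.isAlgebra.mult,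
        ← Strict.assoc, ← M.T.map_comp]
    · rw [hΨ.tgt_eq, whiskerLeft_tgt, whiskerLeft_tgt, ← Strict.assoc, ← Strict.assoc,
        B.isAlgebra.mult]
    · have := transports_map_comp hqs.comm hps.comm.symm hφ hΨ
      rwa [← Strict.assoc, E.isAlgebra.mult, Strict.assoc] at this
  obtain ⟨f, rfl, hf⟩ := LaxHom.exists_of_isComp rfl rfl hunit (hmult ▸ hΨ)
  exact ⟨f, rfl, hf ▸ hφ⟩

theorem exists_classifies (hK : IsPlumbus K) (hu : IsTwoClassifier S q.hom)
    (hqs : q.IsStrict) (sqU : IsTwoPullback U'.str (M.T.map q.hom) q.hom U.str)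
    (hT : M.PreservesPullbacksOf q.hom) (hpt : IsTight p) (hpS : S.Small p.hom) :
    ∃ f : B ⟶ U, Classifies q p f := by
  have hp := (S.tightDiscOpfib hpS).discOpfib
  obtain ⟨g, top, sq⟩ := hu.exists_classifies p.hom hpS
  obtain ⟨f, rfl, hf⟩ := exists_transports_lax hK hu hqs sqU hT hpt.1 sq.toIsTwoPullback
  obtain ⟨t, rfl, sq'⟩ := exists_isTwoPullback_of_transports hpt.1 hp hqs hu.discOpfib
    sq.toIsTwoPullback hf
  exact ⟨f, t, isLeftTightPullback_of_underlying hpt hp (fun _ _ => hu.detects_tight hpS) hqs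
    hu.discOpfib sq'.w sq.toIsTwoPullback⟩

end Classification

end EnhancedMonad

section SplitEquivalence

open TwoCell

variable {K : Type u} [Bicategory.{w, v} K] [Bicategory.Strict K]

/- For `θ : δ ≫ s ≅ 𝟙`, the composite of `θ⁻¹` whiskered by `δ ≫ s` with `θ` goes from `δ ≫ s` to
the identity; it becomes an identity after composition with `δ`, hence is itself one. -/
theorem IsDiscOpfib.isSplitEquivalence_iff {P P' B : K} {l : P ⟶ B} {l' : P' ⟶ B}
    (hl : IsDiscOpfib l) {δ : P ⟶ P'} (hδ : δ ≫ l' = l) :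
    IsSplitEquivalence δ ↔ ∃ s : P' ⟶ P, s ≫ δ = 𝟙 P' ∧ δ ≫ s = 𝟙 P := by
  refine ⟨?_, fun ⟨s, hsδ, hδs⟩ => ⟨s, hsδ, ⟨eqToIso hδs⟩⟩⟩
  rintro ⟨s, hsδ, ⟨θ⟩⟩
  have hδsδ : (δ ≫ s) ≫ δ = δ := by rw [Strict.assoc, hsδ, Strict.comp_id]
  obtain ⟨Λ, hΛ⟩ := exists_isComp (X := of θ.inv ▷₂ (δ ≫ s)) (Y := of θ.hom) (by
    rw [whiskerRight_tgt, ← Strict.assoc, hδsδ])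
  have hΛδ : Λ ▷₂ δ = of (𝟙 δ) := by
    have h := hΛ.whiskerRight δ
    rw [whiskerRight_whiskerRight, hδsδ] at h
    have h' := (IsComp.mk θ.inv θ.hom).whiskerRight δ
    rw [θ.inv_hom_id, of_id_whiskerRight, Strict.id_comp] at h'
    exact h.unique h'
  have hΛl : (of (𝟙 l)).Transports l (δ ≫ s) (𝟙 P) :=
    ⟨Λ, hΛ.src_eq.trans (Strict.id_comp _), hΛ.tgt_eq, by
      rw [← hδ, ← whiskerRight_whiskerRight, hΛδ, of_id_whiskerRight]⟩
  have h := transports_id (δ ≫ s) l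
  rw [← hδ, ← Strict.assoc, hδsδ, hδ] at h
  exact ⟨s, hsδ, hl.transports_unique h hΛl⟩

variable [Enhancement K] {Ω' Ω : K} {u : Ω' ⟶ Ω} {S : SmallClass K}

namespace IsTwoClassifier

variable {P P' B : K} {t : P ⟶ Ω'} {l : P ⟶ B} {f : B ⟶ Ω} {t' : P' ⟶ Ω'} {l' : P' ⟶ B}
  {f' : B ⟶ Ω}

theorem comp_eq_id_iff (hK : IsPlumbus K) (hu : IsTwoClassifier S u)
    (sq : IsTwoPullback t l u f) {φ : f ⟶ f'} {ψ : f' ⟶ f} {δ : P ⟶ P'} {s : P' ⟶ P}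
    (hδ : δ ≫ l' = l) (hs : s ≫ l = l') (hφ : (l ◁₂ of φ).Transports u t (δ ≫ t'))
    (hψ : (l' ◁₂ of ψ).Transports u t' (s ≫ t)) : φ ≫ ψ = 𝟙 f ↔ δ ≫ s = 𝟙 P := by
  have hφψ : (l ◁₂ of (φ ≫ ψ)).Transports u t (δ ≫ s ≫ t) := by
    have := hψ.whiskerLeft δ
    rw [whiskerLeft_whiskerLeft, hδ] at this
    exact hφ.comp this ((IsComp.mk φ ψ).whiskerLeft l)
  have hid : (l ◁₂ of (𝟙 f)).Transports u t t := by
    rw [whiskerLeft_of_id, ← sq.w]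
    exact transports_id t u
  constructor
  · intro h
    rw [h] at hφψ
    refine sq.hom_ext ?_ ?_
    · rw [Strict.assoc, Strict.id_comp, hu.discOpfib.transports_unique hφψ hid]
    · rw [Strict.assoc, Strict.id_comp, hs, hδ]
  · intro h
    rw [← Strict.assoc, h, Strict.id_comp] at hφψ
    exact of_injective (hu.cell_ext hK sq rfl rfl rfl hφψ hid)

theorem isIso_iff (hK : IsPlumbus K) (hu : IsTwoClassifier S u) (sq : IsTwoPullback t l u f)
    (sq' : IsTwoPullback t' l' u f') {φ : f ⟶ f'} {δ : P ⟶ P'} (hδ : δ ≫ l' = l)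
    (hφ : (l ◁₂ of φ).Transports u t (δ ≫ t')) :
    IsIso φ ↔ ∃ s : P' ⟶ P, s ≫ δ = 𝟙 P' ∧ δ ≫ s = 𝟙 P := by
  constructor
  · intro
    obtain ⟨e, he⟩ := hu.discOpfib.exists_transports (Φ := l' ◁₂ of (inv φ)) sq'.w
    obtain ⟨s, ⟨rfl, hs⟩, -⟩ := sq.existsUnique_lift e l' he.tgt_eq
    exact ⟨s, (hu.comp_eq_id_iff hK sq' hs hδ he hφ).1 (IsIso.inv_hom_id φ),
      (hu.comp_eq_id_iff hK sq hδ hs hφ he).1 (IsIso.hom_inv_id φ)⟩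
  · rintro ⟨s, hsδ, hδs⟩
    have hs : s ≫ l = l' := by rw [← hδ, ← Strict.assoc, hsδ, Strict.id_comp]
    obtain ⟨ψ, hψ, -⟩ := hu.existsUnique_cell hK sq' (f' := f) (e' := s ≫ t) (by
      rw [Strict.assoc, sq.w, ← Strict.assoc, hs])
    exact ⟨ψ, (hu.comp_eq_id_iff hK sq hδ hs hφ hψ).2 hδs,
      (hu.comp_eq_id_iff hK sq' hs hδ hψ hφ).2 hsδ⟩

end IsTwoClassifier

end SplitEquivalence

namespace EnhancedMonad

variable {K : Type u} [Bicategory.{w, v} K] [Bicategory.Strict K] [Enhancement K]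
  {M : EnhancedMonad K} {S : SmallClass K} {E B U' U : M.Alg} {q : U' ⟶ U} {p : E ⟶ B}
  {f : B ⟶ U}

theorem isPseudo_iff_isSplitEquivalence (hK : IsPlumbus K) (hu : IsTwoClassifier S q.hom)
    (hqs : q.IsStrict) (sqU : IsTwoPullback U'.str (M.T.map q.hom) q.hom U.str)
    (hT : M.PreservesPullbacksOf q.hom) (hps : p.IsStrict) (hf : Classifies q p f) {P : K}
    {top : P ⟶ E.carrier} {left : P ⟶ M.T.obj B.carrier}
    (sq : IsTwoPullback top left p.hom B.str) :
    f.IsPseudo ↔ IsSplitEquivalence (cartesianityDefect p hps sq) := by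
  have hu' := S.tightDiscOpfib hu.small
  obtain ⟨t, sqA⟩ := hf
  have sqK := isTwoPullback_hom hK hqs hu' sqA.toIsTwoPullback
  have sqT := (hT.map hK hu' sqK).paste sqU
  have defect_left : cartesianityDefect p hps sq ≫ left = M.T.map p.hom := sq.lift_left _ _ _
  rw [(sqT.isDiscOpfib hu.discOpfib).isSplitEquivalence_iff defect_left]
  refine hu.isIso_iff hK sqT (sq.paste sqK) defect_left ?_
  have h := transports_lax hps hqs sqA.w
  rwa [← show cartesianityDefect p hps sq ≫ top = E.str from sq.lift_top _ _ _,
    Strict.assoc] at h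

theorem isPseudo_iff_isTCartesian (hK : IsPlumbus K) (hu : IsTwoClassifier S q.hom)
    (hqs : q.IsStrict) (sqU : IsTwoPullback U'.str (M.T.map q.hom) q.hom U.str)
    (hT : M.PreservesPullbacksOf q.hom) (hps : p.IsStrict) (hp : IsTightDiscOpfib p.hom)
    (hf : Classifies q p f) : f.IsPseudo ↔ IsTCartesian p hps := by
  constructor
  · intro h
    obtain ⟨P, top, left, sq⟩ := hK.exists_pullback p.hom B.str hp
    exact ⟨P, top, left, sq.toIsTwoPullback,
      (isPseudo_iff_isSplitEquivalence hK hu hqs sqU hT hps hf sq.toIsTwoPullback).1 h⟩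
  · rintro ⟨P, top, left, sq, h⟩
    exact (isPseudo_iff_isSplitEquivalence hK hu hqs sqU hT hps hf sq).2 h

end EnhancedMonad

theorem mainTheorem2_general {K : Type u} [Bicategory.{w, v} K] [Bicategory.Strict K]
    [Enhancement K] (hK : IsPlumbus K) {S : SmallClass K} {Ω' Ω : K} {u : Ω' ⟶ Ω}
    (hu : IsTwoClassifier S u) {M : EnhancedMonad K} {ω' : M.T.obj Ω' ⟶ Ω'}
    {ω : M.T.obj Ω ⟶ Ω} (hω : M.IsAlgebra ω) (sqω : IsTwoPullback ω' (M.T.map u) u ω)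
    (hT : M.PreservesPullbacksOf u) :
    ∃ hω' : M.IsAlgebra ω', ∀ {E B : M.Alg} (p : E ⟶ B) (hp : IsTight p), S.Small p.hom →
      (∃ dp : B ⟶ ⟨Ω, ω, hω⟩, Classifies (EnhancedMonad.LaxHom.ofStrict (A := ⟨Ω', ω', hω'⟩)
        (B := ⟨Ω, ω, hω⟩) u sqω.w.symm) p dp) ∧
      ∀ dp : B ⟶ ⟨Ω, ω, hω⟩, Classifies (EnhancedMonad.LaxHom.ofStrict (A := ⟨Ω', ω', hω'⟩)
        (B := ⟨Ω, ω, hω⟩) u sqω.w.symm) p dp →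
          (dp.IsPseudo ↔ EnhancedMonad.IsTCartesian p hp.1) := by
  refine ⟨hT.isAlgebra_top hK hu sqω hω, fun p hp hpS => ⟨?_, fun dp hdp => ?_⟩⟩
  · exact EnhancedMonad.exists_classifies hK hu (EnhancedMonad.LaxHom.isStrict_ofStrict _ _) sqω
      hT hp hpS
  · exact EnhancedMonad.isPseudo_iff_isTCartesian hK hu
      (EnhancedMonad.LaxHom.isStrict_ofStrict _ _) sqω hT hp.1 (S.tightDiscOpfib hpS) hdp

theorem mainTheorem2 {K : Type u} [Bicategory.{w, v} K] [Bicategory.Strict K] [Enhancement K]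
    (hK : IsPlumbus K) (S : SmallClass K) {Ω' Ω : K} (u : Ω' ⟶ Ω) (hu : IsTwoClassifier S u)
    (M : EnhancedMonad K) (ω' : M.T.obj Ω' ⟶ Ω') (ω : M.T.obj Ω ⟶ Ω)
    (h : EnhancedMonad.LiftingHypotheses S M u ω' ω) :
    ∃ h' : M.IsAlgebra ω', ∀ (E B : M.Alg) (p : E ⟶ B) (hp : IsTightDiscOpfib p),
      S.Small p.hom →
        (∃ dp : B ⟶ h.algΩ, Classifies (h.algU h') p dp) ∧
        ∀ dp : B ⟶ h.algΩ, Classifies (h.algU h') p dp →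
          (dp.IsPseudo ↔ EnhancedMonad.IsTCartesian p (EnhancedMonad.isStrict_of_isTight hp.tight)) := by
  obtain ⟨h', H⟩ := mainTheorem2_general hK hu ⟨h.tight, h.unit, h.mult⟩
    h.classifies.toIsTwoPullback fun _ _ _ _ _ => h.preserves_pullback
  exact ⟨h', fun _ _ p hp => H p hp.tight⟩
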